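/- **Conventions.** For an ordinal $\Lambda$, formulas of $\mathsf L_\Lambda$ are built from $\top$ and countably many propositional variables by $\neg,\wedge,\vee,\to$ and modalities $[\xi]$, $\xi<\Lambda$; $\langle\xi\rangle$ abbreviates $\neg[\xi]\neg$. The logic $\mathsf{GLP}_\Lambda$ has as axioms all propositional tautologies, $[\xi](\phi\to\psi)\to([\xi]\phi\to[\xi]\psi)$, $[\xi]([\xi]\phi\to\phi)\to[\xi]\phi$, and, for $\xi<\zeta<\Lambda$, $[\xi]\phi\to[\zeta]\phi$ and $\langle\xi\rangle\phi\to[\zeta]\langle\xi\rangle\phi$; its rules are modus ponens and necessitation for each $[\xi]$. Let $e(\xi)=-1+\omega^\xi$, and let $\langle e^\zeta\rangle_{\zeta}$ be the pointwise least family of normal functions on the ordinals with $e^1=e$ and $e^{\alpha+\beta}=e^\alpha e^\beta$. Let $\ell 0=0$ and $\ell(\alpha+\omega^\beta)=\beta$. The hyperlogarithms $\langle\ell^\zeta\rangle_\zeta$ are given by $\ell^0=\mathrm{id}$, $\ell^{\zeta+1}=\ell\ell^\zeta$ and, for a limit $\zeta=\alpha+\omega^\beta$, $\ell^\zeta\xi=\gamma$,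 where $e^{\omega^\beta}\gamma$ is the eventual value of $\ell^\vartheta\xi$ for $\vartheta<\zeta$; they form a pointwise maximal family of initial functions with $\ell^1=\ell$ and $\ell^{\alpha+\beta}=\ell^\beta\ell^\alpha$. A *$\Lambda$-ambiance* is a set $X$ with topologies $\langle\mathcal T_\xi\rangle_{\xi<\Lambda}$, whose derived set (set of limit points) operators are denoted $d_\xi$, and a Boolean algebra $\mathcal A\subseteq\mathcal P(X)$ closed under all $d_\xi$. A *valuation* assigns to each formula a member of $\mathcal A$, respecting Boolean connectives and satisfying $[\![\langle\xi\rangle\phi]\!]=d_\xi[\![\phi]\!]$; $\phi$ is *valid* if $[\![\phi]\!]=X$ for every valuation. The ambiance is a *provability ambiance* if every $\mathcal T_\xi$ is scattered (each nonempty subset has an isolated point), $\mathcal T_\xi\subseteq\mathcal T_\zeta$ for $\xi\le\zeta$, and $d_\xi A\in\mathcal T_\zeta$ for $A\in\mathcal A$, $\xi<\zeta$. The logic $\mathsf{GLP}_\Lambda$ is *complete* for a class of ambiances if it proves every formula of $\mathsf L_\Lambda$ valid on all members of the class. Let $\Theta$ be an ordinal. On $\Theta$, let $\mathcal I_0$ consist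 of the downward closed sets, and for $\xi>0$ let $\mathcal I_\xi$ be generated by the sets $\{\vartheta<\Theta:\ell^\eta\vartheta\le\beta\}$ and $\{\vartheta<\Theta:\alpha<\ell^\eta\vartheta\le\beta\}$ with $\alpha<\beta\le\Theta$ (and, in the first case, any $\beta\le\Theta$) and $\eta<\xi$. An *Icard ambiance* (respectively *shifted Icard ambiance*) based on $\Theta$ is a provability ambiance with topologies $\langle\mathcal I_\xi\rangle_{\xi<\Lambda}$ (respectively $\langle\mathcal I_{1+\xi}\rangle_{\xi<\Lambda}$). In a scattered space $\langle X,\mathcal T\rangle$ with derived set operator $d$, the rank of $x$ is the least $\alpha$ with $x\notin d^{\alpha+1}X$, where $d^0X=X$, $d^{\xi+1}X=d\,d^\xi X$ and $d^\lambda X=\bigcap_{\xi<\lambda}d^\xi X$ for limit $\lambda$. A topology $\mathcal T'\supseteq\mathcal T$ is a *limit-refinement* of $\mathcal T$ if it has the same rank function and, at each point whose rank is not a limit ordinal, every $\mathcal T'$-neighbourhood contains a $\mathcal T$-neighbourhood; it is a *limit-maximal refinement* of $\mathcal T$ if moreover no limit-refinement of $\mathcal T$ properly extends it. A *BG-space*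 based on $\Theta$ is given by topologies $\langle\mathcal T_\xi\rangle_{\xi<\Lambda}$ on $\Theta$ such that $\mathcal T_0$ is a limit-maximal refinement of the interval topology (generated by the sets $[0,\beta]$ and $(\alpha,\beta]$) and, for $0<\xi<\Lambda$, $\mathcal T_\xi$ is a limit-maximal refinement of $\mathcal T_\xi^-$. Here $\mathcal T_{\zeta+1}^-$ is generated by $\mathcal T_\zeta\cup\{d_\zeta S:S\subseteq\Theta\}$, and $\mathcal T^-_\xi$ is generated by $\bigcup_{\zeta<\xi}\mathcal T_\zeta$ for limit $\xi$. A BG-space is regarded as an ambiance with $\mathcal A=\mathcal P(\Theta)$. **Theorem.** Let $\Lambda>0$ and let $\Theta<e^{1+\Lambda}1$ be a fixed ordinal. Then $\mathsf{GLP}_\Lambda$ is not complete for the class consisting of all BG-spaces and all Icard ambiances, shifted or not, that are based on $\Theta$: some formula of $\mathsf L_\Lambda$ that is not a theorem of $\mathsf{GLP}_\Lambda$ is valid on all of them. In particular, $\mathsf{GLP}_\Lambda$ is incomplete for the class of BG-spaces based on $\Theta$, for the class of Icard ambiances based on $\Theta$, and for the class of shifted Icard ambiances based on $\Theta$. -/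

import Mathlib

universe u v

namespace PolyGLP

open Ordinal Set
open scoped Topology

noncomputable section

/-- The function `e ξ = -1 + ω ^ ξ`. -/
def expBase (ξ : Ordinal.{u}) : Ordinal.{u} := ω ^ ξ - 1

/-- The hyperexponential `e ^ ζ`. For `ζ = ω ^ ρ` it enumerates the common fixed points of all
`e ^ (ω ^ σ)` with `σ < ρ`; otherwise write `ζ = ω ^ ρ + ζ'` with `ω ^ ρ ≤ ζ < ω ^ (ρ + 1)` and
compose. -/
def hyperexp (ζ : Ordinal.{u}) : Ordinal.{u} → Ordinal.{u} :=
  if _h : ζ = 0 then id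
  else veblenWith expBase (log ω ζ) ∘ hyperexp (ζ - ω ^ log ω ζ)
termination_by ζ
decreasing_by exact sub_omega0_opow_log_lt _h

/-- Families of normal functions with `e ^ 1 = e` and `e ^ (α + β) = e ^ α ∘ e ^ β`. -/
structure IsHyperexpFamily (g : Ordinal.{u} → Ordinal.{u} → Ordinal.{u}) : Prop where
  normal : ∀ ζ, Order.IsNormal (g ζ)
  one : g 1 = expBase
  add : ∀ α β, g (α + β) = g α ∘ g β

theorem expBase_zero : expBase 0 = 0 := by simp [expBase]

theorem expBase_of_pos {ξ : Ordinal.{u}} (h : ξ ≠ 0) : expBase ξ = ω ^ ξ := by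
  apply sub_eq_of_add_eq
  exact one_add_of_omega0_le (by simpa using opow_le_opow_right omega0_pos (Order.one_le_iff_pos.2 <| pos_iff_ne_zero.2 h))

theorem expBase_normal : Order.IsNormal expBase.{u} := by
  have key : ∀ ξ, 1 + expBase ξ = ω ^ ξ := fun ξ ↦
    Ordinal.add_sub_cancel_of_le (Order.one_le_iff_pos.2 <| pos_iff_ne_zero.2 (opow_pos ξ omega0_pos).ne')
  have hm : StrictMono expBase.{u} := by
    intro a b hab
    have := opow_lt_opow_iff_right one_lt_omega0 |>.2 hab
    rw [← key, ← key] at this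
    exact (add_lt_add_iff_left 1).1 this
  refine Order.IsNormal.of_succ_lt (fun a ↦ hm (Order.lt_succ a)) fun {a} ha ↦ ?_
  refine ⟨?_, ?_⟩
  · rintro _ ⟨b, hb, rfl⟩
    exact hm.monotone (le_of_lt hb)
  · intro c hc
    rw [expBase_of_pos ha.ne_bot]
    refine ((isNormal_opow one_lt_omega0).le_iff_forall_le ha).2 fun b hb ↦ ?_
    have hb' := ha.succ_lt hb
    refine le_trans ?_ (hc ⟨_, hb', rfl⟩)
    rw [expBase_of_pos (by simp)]
    exact opow_le_opow_right omega0_pos (Order.le_succ b)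

theorem hyperexp_zero : hyperexp 0 = id := by
  rw [hyperexp, dif_pos rfl]

theorem hyperexp_opow_add (ρ β : Ordinal.{u}) :
    hyperexp (ω ^ ρ + β) = veblenWith expBase ρ ∘ hyperexp β := by
  have h0 : ω ^ ρ ≠ 0 := (opow_pos ρ omega0_pos).ne'
  rcases le_or_gt (log ω β) ρ with h | h
  · have hl : log ω (ω ^ ρ + β) = ρ := by
      apply le_antisymm
      · rw [← Order.lt_succ_iff, ← lt_opow_iff_log_lt one_lt_omega0 (by simp [h0])]
        refine isPrincipal_add_omega0_opow _ ?_ ?_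
        · exact (opow_lt_opow_iff_right one_lt_omega0).2 (Order.lt_succ ρ)
        · exact lt_opow_of_log_lt one_lt_omega0 (Order.lt_succ_iff.2 h)
      · exact le_log_of_opow_le one_lt_omega0 le_self_add
    rw [hyperexp, dif_neg (by simp [h0]), hl, Ordinal.add_sub_cancel]
  · have hβ : β ≠ 0 := by rintro rfl; simp at h
    have hle := opow_log_le_self ω hβ
    rw [add_of_omega0_opow_le ((opow_lt_opow_iff_right one_lt_omega0).2 h) hle]
    rw [hyperexp, dif_neg hβ]
    funext x
    exact (veblenWith_veblenWith_of_lt expBase_normal h _).symm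

theorem hyperexp_opow (ρ : Ordinal.{u}) : hyperexp (ω ^ ρ) = veblenWith expBase ρ := by
  simpa [hyperexp_zero] using hyperexp_opow_add ρ 0

/-- Induction along the leading terms of Cantor normal forms. -/
theorem cnf_induction {P : Ordinal.{u} → Prop} (zero : P 0)
    (step : ∀ ρ β : Ordinal.{u}, P β → P (ω ^ ρ + β)) (α : Ordinal.{u}) : P α := by
  induction α using WellFoundedLT.induction with
  | ind α ih =>
    rcases eq_or_ne α 0 with rfl | h
    · exact zero
    · have := step (log ω α) _ (ih _ (sub_omega0_opow_log_lt h))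
      rwa [Ordinal.add_sub_cancel_of_le (opow_log_le_self ω h)] at this

theorem hyperexp_family : IsHyperexpFamily hyperexp.{u} where
  normal := cnf_induction (by rw [hyperexp_zero]; exact .id) fun ρ β h ↦ by
    rw [hyperexp_opow_add]
    exact (isNormal_veblenWith expBase_normal ρ).comp h
  one := by rw [← opow_zero ω, hyperexp_opow, veblenWith_zero]
  add α β := by
    refine cnf_induction (P := fun α ↦ hyperexp (α + β) = hyperexp α ∘ hyperexp β) ?_ ?_ α
    · simp [hyperexp_zero]
    · intro ρ α' h
      rw [add_assoc, hyperexp_opow_add, hyperexp_opow_add, h]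
      rfl

theorem range_hyperexp_opow {ρ ν : Ordinal.{u}} (h0 : ρ ≠ 0)
    (h : ∀ σ < ρ, hyperexp (ω ^ σ) ν ≤ ν) : ∃ γ, hyperexp (ω ^ ρ) γ = ν := by
  rw [hyperexp_opow]
  refine (mem_range_veblenWith expBase_normal h0).2 fun σ hσ ↦ ?_
  have := h σ hσ
  rw [hyperexp_opow] at this
  exact this.antisymm (isNormal_veblenWith expBase_normal σ).strictMono.le_apply

/-- The hyperexponentials are the pointwise least family of normal functions with `e ^ 1 = e` and
`e ^ (α + β) = e ^ α ∘ e ^ β`. -/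
theorem hyperexp_isLeast : IsLeast {g | IsHyperexpFamily g} hyperexp.{u} := by
  refine ⟨hyperexp_family, fun g hg ↦ ?_⟩
  have hz : g 0 = id := by
    funext x
    have := congrFun (hg.add 0 0) x
    rw [add_zero] at this
    exact ((hg.normal 0).strictMono.injective this).symm
  have hpow : ∀ ρ x : Ordinal.{u}, hyperexp (ω ^ ρ) x ≤ g (ω ^ ρ) x := by
    intro ρ
    induction ρ using WellFoundedLT.induction with
    | ind ρ ih =>
      rcases eq_or_ne ρ 0 with rfl | h0
      · simp [hg.one, hyperexp_family.one]
      · intro x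
        induction x using WellFoundedLT.induction with
        | ind x ihx =>
          obtain ⟨γ, hγ⟩ := range_hyperexp_opow (ν := g (ω ^ ρ) x) h0 fun σ hσ ↦ by
            refine (ih σ hσ _).trans_eq ?_
            have := hg.add (ω ^ σ) (ω ^ ρ)
            rw [add_omega0_opow ((opow_lt_opow_iff_right one_lt_omega0).2 hσ)] at this
            exact (congrFun this x).symm
          rw [← hγ]
          refine (hyperexp_family.normal _).monotone (le_of_not_gt fun hlt ↦ ?_)
          have h1 := ihx γ hlt
          rw [hγ] at h1
          exact h1.not_gt ((hg.normal _).strictMono hlt)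
  intro ζ
  refine cnf_induction (P := fun ζ ↦ hyperexp ζ ≤ g ζ) ?_ ?_ ζ
  · rw [hyperexp_zero, hz]
  · intro ρ β h x
    rw [hyperexp_family.add, hg.add]
    exact (hpow ρ _).trans ((hg.normal _).monotone (h x))

/-- The function `ℓ`: for `ξ = α + ω ^ β` we have `ℓ ξ = β`, and `ℓ 0 = 0`. -/
def endLog (ξ : Ordinal.{u}) : Ordinal.{u} := sInf {β | ∃ α, ξ = α + ω ^ β}

/-- The hyperlogarithm `ℓ ^ ζ`. We put `ℓ ^ 0 = id` and `ℓ ^ (ζ + 1) = ℓ ∘ ℓ ^ ζ`. If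
`ζ = α + ω ^ β` is a limit, then `ℓ ^ ζ ξ` is the `γ` such that `e ^ (ω ^ β) γ` is the eventual value
of the non-increasing sequence of all `ℓ ^ ϑ ξ` with `ϑ < ζ`. -/
def hyperlog (ζ : Ordinal.{u}) : Ordinal.{u} → Ordinal.{u} :=
  limitRecOn ζ id (fun _ f ↦ endLog ∘ f)
    (fun ζ _ f ξ ↦ sInf {γ | ∃ ϑ, ∃ h : ϑ < ζ, f ϑ h ξ ≤ hyperexp (ω ^ endLog ζ) γ})

/-- Families of initial functions with `ℓ ^ 1 = ℓ` and `ℓ ^ (α + β) = ℓ ^ β ∘ ℓ ^ α`. -/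
structure IsHyperlogFamily (g : Ordinal.{u} → Ordinal.{u} → Ordinal.{u}) : Prop where
  initial : ∀ ζ a, IsLowerSet (g ζ '' Iio a)
  one : g 1 = endLog
  add : ∀ α β, g (α + β) = g β ∘ g α

theorem endLog_add_opow (α β : Ordinal.{u}) : endLog (α + ω ^ β) = β := by
  have key : ∀ γ δ γ' δ' : Ordinal.{u}, δ < δ' → γ + ω ^ δ ≠ γ' + ω ^ δ' := by
    intro γ δ γ' δ' h he
    have hδ := (opow_lt_opow_iff_right one_lt_omega0).2 h
    have h1 : γ < γ' + ω ^ δ' :=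
      he ▸ lt_add_of_pos_right γ (opow_pos δ omega0_pos)
    have h2 : γ - γ' < ω ^ δ' := sub_lt_of_lt_add h1 (opow_pos _ omega0_pos)
    have h3 : γ + ω ^ δ ≤ γ' + ((γ - γ') + ω ^ δ) := by
      rw [← add_assoc]
      exact add_le_add_left (le_add_sub _ _) _
    have h4 : γ' + ((γ - γ') + ω ^ δ) < γ' + ω ^ δ' :=
      (add_lt_add_iff_left _).2 (isPrincipal_add_omega0_opow δ' h2 hδ)
    exact (h3.trans_lt h4).ne he
  have hs : {b | ∃ a, α + ω ^ β = a + ω ^ b} = {β} := by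
    ext b
    refine ⟨?_, fun h ↦ ⟨α, by rw [h]⟩⟩
    rintro ⟨a, h⟩
    rcases lt_trichotomy b β with hb | hb | hb
    · exact absurd h.symm (key _ _ _ _ hb)
    · exact hb
    · exact absurd h (key _ _ _ _ hb)
  rw [endLog, hs, csInf_singleton]

theorem endLog_opow (β : Ordinal.{u}) : endLog (ω ^ β) = β := by
  simpa using endLog_add_opow 0 β

theorem endLog_zero : endLog.{u} 0 = 0 := by
  have hs : {b : Ordinal.{u} | ∃ a, 0 = a + ω ^ b} = ∅ := by
    ext b
    simp only [mem_ofPred_eq, mem_empty_iff_false, iff_false, not_exists]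
    intro a h
    exact (opow_pos b omega0_pos).ne' (le_zero_iff.1 (h ▸ le_add_self))
  rw [endLog, hs]
  exact Ordinal.sInf_empty

theorem exists_eq_add_opow {ξ : Ordinal.{u}} (h : ξ ≠ 0) : ∃ α β : Ordinal.{u}, ξ = α + ω ^ β := by
  revert h
  refine cnf_induction (P := fun ξ ↦ ξ ≠ 0 → ∃ α β : Ordinal.{u}, ξ = α + ω ^ β) (by simp) ?_ ξ
  intro ρ β ih _
  rcases eq_or_ne β 0 with rfl | hβ
  · exact ⟨0, ρ, by simp⟩
  · obtain ⟨a, b, rfl⟩ := ih hβ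
    exact ⟨ω ^ ρ + a, b, by rw [add_assoc]⟩

theorem endLog_le (ξ : Ordinal.{u}) : endLog ξ ≤ ξ := by
  rcases eq_or_ne ξ 0 with rfl | h
  · simp [endLog_zero]
  · obtain ⟨a, b, rfl⟩ := exists_eq_add_opow h
    rw [endLog_add_opow]
    exact (right_le_opow b one_lt_omega0).trans le_add_self

theorem endLog_add (α : Ordinal.{u}) {β : Ordinal.{u}} (h : β ≠ 0) :
    endLog (α + β) = endLog β := by
  obtain ⟨a, b, rfl⟩ := exists_eq_add_opow h
  rw [← add_assoc, endLog_add_opow, endLog_add_opow]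

theorem hyperlog_zero : hyperlog.{u} 0 = id := limitRecOn_zero ..

theorem hyperlog_add_one (ζ : Ordinal.{u}) : hyperlog (ζ + 1) = endLog ∘ hyperlog ζ :=
  limitRecOn_add_one ..

theorem hyperlog_limit {ζ : Ordinal.{u}} (h : Order.IsSuccLimit ζ) (ξ : Ordinal.{u}) :
    hyperlog ζ ξ = sInf {γ | ∃ ϑ < ζ, hyperlog ϑ ξ ≤ hyperexp (ω ^ endLog ζ) γ} := by
  have := congrFun (limitRecOn_limit (motive := fun _ ↦ Ordinal.{u} → Ordinal.{u}) ζ id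
    (fun _ f ↦ endLog ∘ f)
    (fun ζ _ f ξ ↦ sInf {γ | ∃ ϑ, ∃ h : ϑ < ζ, f ϑ h ξ ≤ hyperexp (ω ^ endLog ζ) γ}) h) ξ
  refine Eq.trans this ?_
  simp only [exists_prop]
  rfl

theorem hyperlog_antitone (ξ : Ordinal.{u}) : Antitone fun ζ ↦ hyperlog ζ ξ := by
  intro a b
  induction b using limitRecOn with
  | zero => intro h; rw [le_zero_iff.1 h]
  | add_one b ih =>
    intro h
    rcases h.eq_or_lt with rfl | h
    · exact le_rfl
    · change hyperlog (b + 1) ξ ≤ _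
      rw [hyperlog_add_one]
      exact (endLog_le _).trans (ih (Order.lt_add_one_iff.1 h))
  | limit b hb ih =>
    intro h
    rcases h.eq_or_lt with rfl | h
    · exact le_rfl
    · change hyperlog b ξ ≤ _
      rw [hyperlog_limit hb]
      exact csInf_le' ⟨a, h, (hyperexp_family.normal _).strictMono.le_apply⟩

theorem hyperlog_add (α β : Ordinal.{u}) : hyperlog (α + β) = hyperlog β ∘ hyperlog α := by
  induction β using WellFoundedLT.induction with
  | ind β ih =>
    rcases zero_or_succ_or_isSuccLimit β with rfl | ⟨b, rfl⟩ | hb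
    · simp [hyperlog_zero]
    · rw [Order.succ_eq_add_one, ← add_assoc, hyperlog_add_one, hyperlog_add_one, ih b (by simp)]
      rfl
    · funext ξ
      have hb0 : β ≠ 0 := hb.ne_bot
      rw [hyperlog_limit (isSuccLimit_add α hb), Function.comp_apply, hyperlog_limit hb,
        endLog_add α hb0]
      congr 1
      ext γ
      constructor
      · rintro ⟨ϑ, hϑ, h⟩
        rcases lt_or_ge ϑ α with hlt | hge
        · refine ⟨0, pos_iff_ne_zero.2 hb0, ?_⟩
          rw [hyperlog_zero]
          exact (hyperlog_antitone ξ hlt.le).trans h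
        · have he := Ordinal.add_sub_cancel_of_le hge
          have hlt : ϑ - α < β := (sub_lt_of_le hge).2 hϑ
          refine ⟨ϑ - α, hlt, ?_⟩
          have := congrFun (ih _ hlt) ξ
          rw [he] at this
          rw [this] at h
          exact h
      · rintro ⟨η, hη, h⟩
        exact ⟨α + η, (add_lt_add_iff_left α).2 hη, by rw [ih η hη]; exact h⟩

/-- Induction along sums and powers of `ω`. -/
theorem opow_induction {P : Ordinal.{u} → Prop} (zero : P 0)
    (opow : ∀ ρ : Ordinal.{u}, (∀ ϑ < ω ^ ρ, P ϑ) → P (ω ^ ρ))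
    (add : ∀ α β, P α → P β → P (α + β)) (ζ : Ordinal.{u}) : P ζ := by
  induction ζ using WellFoundedLT.induction with
  | ind ζ ih =>
    rcases eq_or_ne ζ 0 with rfl | h
    · exact zero
    · have hle := opow_log_le_self ω h
      rcases hle.eq_or_lt with he | hlt
      · have := opow (log ω ζ) (by rwa [he])
        rwa [he] at this
      · have := add _ _ (ih _ hlt) (ih _ (sub_omega0_opow_log_lt h))
        rwa [Ordinal.add_sub_cancel_of_le hle] at this

theorem hyperlog_one : hyperlog.{u} 1 = endLog := by
  rw [← zero_add (1 : Ordinal.{u}), hyperlog_add_one, hyperlog_zero]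
  rfl

theorem isSuccLimit_omega0_opow {ρ : Ordinal.{u}} (h : ρ ≠ 0) : Order.IsSuccLimit (ω ^ ρ) :=
  isSuccLimit_opow_left isSuccLimit_omega0 h

/-- `ℓ ^ ζ` is a left inverse of `e ^ ζ`. -/
theorem hyperlog_hyperexp (ζ : Ordinal.{u}) : ∀ ξ, hyperlog ζ (hyperexp ζ ξ) = ξ := by
  refine opow_induction (P := fun ζ ↦ ∀ ξ, hyperlog ζ (hyperexp ζ ξ) = ξ) ?_ ?_ ?_ ζ
  · simp [hyperlog_zero, hyperexp_zero]
  · intro ρ ih ξ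
    rcases eq_or_ne ρ 0 with rfl | h0
    · rw [opow_zero, hyperlog_one, hyperexp_family.one]
      rcases eq_or_ne ξ 0 with rfl | h
      · rw [expBase_zero, endLog_zero]
      · rw [expBase_of_pos h, endLog_opow]
    · rw [hyperlog_limit (isSuccLimit_omega0_opow h0), endLog_opow]
      have hs : {γ | ∃ ϑ < ω ^ ρ, hyperlog ϑ (hyperexp (ω ^ ρ) ξ) ≤ hyperexp (ω ^ ρ) γ} = Ici ξ := by
        have hfix : ∀ ϑ < ω ^ ρ, hyperlog ϑ (hyperexp (ω ^ ρ) ξ) = hyperexp (ω ^ ρ) ξ := by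
          intro ϑ hϑ
          have h1 := congrFun (hyperexp_family.add ϑ (ω ^ ρ)) ξ
          rw [add_omega0_opow hϑ, Function.comp_apply] at h1
          conv_lhs => rw [h1]
          exact ih ϑ hϑ _
        have hm := (hyperexp_family.normal (ω ^ ρ)).strictMono
        ext γ
        constructor
        · rintro ⟨ϑ, hϑ, h⟩
          rw [hfix ϑ hϑ] at h
          exact hm.le_iff_le.1 h
        · intro h
          exact ⟨0, opow_pos ρ omega0_pos, by
            rw [hfix 0 (opow_pos ρ omega0_pos)]; exact hm.monotone h⟩
      rw [hs, csInf_Ici]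
  · intro α β hα hβ ξ
    rw [hyperlog_add, hyperexp_family.add]
    simp [hα, hβ]

theorem hyperlog_eventually_aux {ρ : Ordinal.{u}} (h0 : ρ ≠ 0)
    (ih : ∀ ϑ < ω ^ ρ, ∀ α β, α < hyperexp ϑ β → hyperlog ϑ α < β) (α : Ordinal.{u}) :
    ∃ ϑ < ω ^ ρ, hyperlog ϑ α = hyperexp (ω ^ ρ) (hyperlog (ω ^ ρ) α) := by
  obtain ⟨_, ⟨ϑ, hϑ, rfl⟩, hmin⟩ := WellFounded.has_min (wellFounded_lt (α := Ordinal.{u}))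
    ((fun ϑ ↦ hyperlog ϑ α) '' Iio (ω ^ ρ)) ⟨_, 0, opow_pos ρ omega0_pos, rfl⟩
  obtain ⟨γ, hγ⟩ := range_hyperexp_opow (ν := hyperlog ϑ α) h0 fun σ hσ ↦ by
    by_contra! hlt
    have hσ' := (opow_lt_opow_iff_right one_lt_omega0).2 hσ
    have h1 := ih _ hσ' _ _ hlt
    refine hmin _ ⟨ϑ + ω ^ σ, isPrincipal_add_omega0_opow ρ hϑ hσ', rfl⟩ ?_
    change hyperlog (ϑ + ω ^ σ) α < _
    rw [hyperlog_add]
    exact h1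
  refine ⟨ϑ, hϑ, ?_⟩
  have h2 := congrFun (hyperlog_add ϑ (ω ^ ρ)) α
  rw [add_omega0_opow hϑ, Function.comp_apply, ← hγ, hyperlog_hyperexp] at h2
  rw [h2, hγ]

theorem hyperlog_lt (ζ : Ordinal.{u}) : ∀ α β, α < hyperexp ζ β → hyperlog ζ α < β := by
  refine opow_induction (P := fun ζ ↦ ∀ α β, α < hyperexp ζ β → hyperlog ζ α < β) ?_ ?_ ?_ ζ
  · simp [hyperlog_zero, hyperexp_zero]
  · intro ρ ih α β h
    rcases eq_or_ne ρ 0 with rfl | h0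
    · rw [opow_zero, hyperexp_family.one] at h
      rw [opow_zero, hyperlog_one]
      have hβ : β ≠ 0 := by rintro rfl; simp [expBase_zero] at h
      rw [expBase_of_pos hβ] at h
      rcases eq_or_ne α 0 with rfl | hα
      · rw [endLog_zero]; exact pos_iff_ne_zero.2 hβ
      · obtain ⟨a, b, rfl⟩ := exists_eq_add_opow hα
        rw [endLog_add_opow]
        exact (opow_lt_opow_iff_right one_lt_omega0).1 (le_add_self.trans_lt h)
    · obtain ⟨ϑ, -, hϑ⟩ := hyperlog_eventually_aux h0 ih α
      have h1 := hyperlog_antitone α (bot_le : (0 : Ordinal.{u}) ≤ ϑ)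
      change hyperlog ϑ α ≤ hyperlog 0 α at h1
      rw [hϑ, hyperlog_zero] at h1
      exact (hyperexp_family.normal _).strictMono.lt_iff_lt.1 (h1.trans_lt h)
  · intro a b ha hb α β h
    rw [hyperexp_family.add] at h
    rw [hyperlog_add]
    exact hb _ _ (ha _ _ h)

theorem hyperlog_family : IsHyperlogFamily hyperlog.{u} where
  initial ζ a := by
    rintro _ y hy ⟨η, hη, rfl⟩
    refine ⟨hyperexp ζ y, ?_, hyperlog_hyperexp ζ y⟩
    refine lt_of_le_of_lt (le_of_not_gt fun h ↦ ?_) (mem_Iio.1 hη)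
    exact (hyperlog_lt ζ _ _ h).not_ge hy
  one := hyperlog_one
  add := hyperlog_add

/-- The hyperlogarithms are pointwise maximal among the families of initial functions with
`ℓ ^ 1 = ℓ` and `ℓ ^ (α + β) = ℓ ^ β ∘ ℓ ^ α`. -/
theorem hyperlog_maximal : Maximal IsHyperlogFamily hyperlog.{u} := by
  refine ⟨hyperlog_family, fun g hg hle ↦ ?_⟩
  suffices h : ∀ ζ, g ζ = hyperlog ζ from fun ζ ↦ (h ζ).le
  refine opow_induction ?_ ?_ ?_
  · refine le_antisymm (fun x ↦ ?_) (hle 0)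
    rw [hyperlog_zero]
    induction x using WellFoundedLT.induction with
    | ind x ih =>
      by_contra! h
      obtain ⟨y, hy, hyx⟩ := hg.initial 0 (x + 1) h.le ⟨x, mem_Iio.2 (Order.lt_add_one_iff.2 le_rfl), rfl⟩
      rcases (Order.lt_add_one_iff.1 (mem_Iio.1 hy)).eq_or_lt with rfl | hlt
      · exact h.ne hyx.symm
      · have h1 := ih y hlt
        rw [hyx] at h1
        exact h1.not_gt hlt
  · intro ρ ih
    refine le_antisymm (fun x ↦ ?_) (hle _)
    rcases eq_or_ne ρ 0 with rfl | h0
    · rw [opow_zero, hg.one, hyperlog_one]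
    have hred : ∀ x, g (ω ^ ρ) x = g (ω ^ ρ) (hyperexp (ω ^ ρ) (hyperlog (ω ^ ρ) x)) := by
      intro x
      obtain ⟨ϑ, hϑ, h⟩ := hyperlog_eventually_aux h0 (fun ϑ _ ↦ hyperlog_lt ϑ) x
      have h1 := congrFun (hg.add ϑ (ω ^ ρ)) x
      rw [add_omega0_opow hϑ, Function.comp_apply, ih ϑ hϑ, h] at h1
      exact h1
    rw [hred]
    generalize hyperlog (ω ^ ρ) x = γ
    induction γ using WellFoundedLT.induction with
    | ind γ ihγ =>
      by_contra! h
      obtain ⟨y, hy, hyx⟩ := hg.initial (ω ^ ρ) (hyperexp (ω ^ ρ) γ + 1) h.le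
        ⟨_, mem_Iio.2 (Order.lt_add_one_iff.2 le_rfl), rfl⟩
      rcases (Order.lt_add_one_iff.1 (mem_Iio.1 hy)).eq_or_lt with rfl | hlt
      · exact h.ne hyx.symm
      · have h1 := hyperlog_lt _ _ _ hlt
        have h2 := ihγ _ h1
        rw [← hred, hyx] at h2
        exact h2.not_gt h1
  · intro α β hα hβ
    rw [hg.add, hyperlog_add, hα, hβ]

/-! ### The logic -/

/-- Formulas with propositional variables indexed by `ℕ` and one modality for every `ξ < Λ`. -/
inductive Formula (Λ : Ordinal.{u}) : Type (u + 1)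
  | top : Formula Λ
  | var (n : ℕ) : Formula Λ
  | neg (φ : Formula Λ) : Formula Λ
  | and (φ ψ : Formula Λ) : Formula Λ
  | or (φ ψ : Formula Λ) : Formula Λ
  | imp (φ ψ : Formula Λ) : Formula Λ
  | box (ξ : Iio Λ) (φ : Formula Λ) : Formula Λ

/-- `⟨ξ⟩ φ` abbreviates `¬ [ξ] ¬ φ`. -/
def Formula.dia {Λ : Ordinal.{u}} (ξ : Iio Λ) (φ : Formula Λ) : Formula Λ :=
  .neg (.box ξ (.neg φ))

/-- Truth assignments that respect the Boolean connectives (variables and boxed formulas are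
treated as atoms). -/
structure IsBooleanAssignment {Λ : Ordinal.{u}} (t : Formula Λ → Prop) : Prop where
  top : t .top
  neg : ∀ φ, t (.neg φ) ↔ ¬ t φ
  and : ∀ φ ψ, t (.and φ ψ) ↔ t φ ∧ t ψ
  or : ∀ φ ψ, t (.or φ ψ) ↔ t φ ∨ t ψ
  imp : ∀ φ ψ, t (.imp φ ψ) ↔ (t φ → t ψ)

/-- Propositional tautologies in the modal language. -/
def Formula.IsTautology {Λ : Ordinal.{u}} (φ : Formula Λ) : Prop :=
  ∀ t : Formula Λ → Prop, IsBooleanAssignment t → t φ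

/-- The theorems of the logic `GLP_Λ`. -/
inductive GLP (Λ : Ordinal.{u}) : Formula Λ → Prop
  | taut {φ : Formula Λ} : φ.IsTautology → GLP Λ φ
  | distrib (ξ : Iio Λ) (φ ψ : Formula Λ) :
      GLP Λ (.imp (.box ξ (.imp φ ψ)) (.imp (.box ξ φ) (.box ξ ψ)))
  | loeb (ξ : Iio Λ) (φ : Formula Λ) :
      GLP Λ (.imp (.box ξ (.imp (.box ξ φ) φ)) (.box ξ φ))
  | mono (ξ ζ : Iio Λ) (φ : Formula Λ) : ξ < ζ → GLP Λ (.imp (.box ξ φ) (.box ζ φ))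
  | dia_box (ξ ζ : Iio Λ) (φ : Formula Λ) : ξ < ζ → GLP Λ (.imp (.dia ξ φ) (.box ζ (.dia ξ φ)))
  | mp {φ ψ : Formula Λ} : GLP Λ (.imp φ ψ) → GLP Λ φ → GLP Λ ψ
  | nec (ξ : Iio Λ) {φ : Formula Λ} : GLP Λ φ → GLP Λ (.box ξ φ)

/-! ### Ambiances -/

/-- `d`-algebras: Boolean algebras of sets closed under all derived set operators. -/
structure IsDAlgebra {Λ : Ordinal.{u}} {X : Type v} (T : Iio Λ → TopologicalSpace X)
    (A : Set (Set X)) : Prop where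
  empty_mem : ∅ ∈ A
  compl_mem : ∀ S ∈ A, Sᶜ ∈ A
  union_mem : ∀ S ∈ A, ∀ S' ∈ A, S ∪ S' ∈ A
  derivedSet_mem : ∀ ξ, ∀ S ∈ A, @derivedSet X (T ξ) S ∈ A

/-- A `Λ`-ambiance on `X`: a polytopology with a `d`-algebra. -/
structure Ambiance (Λ : Ordinal.{u}) (X : Type v) where
  topology : Iio Λ → TopologicalSpace X
  algebra : Set (Set X)
  isDAlgebra : IsDAlgebra topology algebra

/-- The truth set of a formula. As `⟨ξ⟩` is the derived set operator, `[ξ]` is its dual. -/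
def Ambiance.eval {Λ : Ordinal.{u}} {X : Type v} (𝔛 : Ambiance Λ X) (V : ℕ → Set X) :
    Formula Λ → Set X
  | .top => Set.univ
  | .var n => V n
  | .neg φ => (𝔛.eval V φ)ᶜ
  | .and φ ψ => 𝔛.eval V φ ∩ 𝔛.eval V ψ
  | .or φ ψ => 𝔛.eval V φ ∪ 𝔛.eval V ψ
  | .imp φ ψ => (𝔛.eval V φ)ᶜ ∪ 𝔛.eval V ψ
  | .box ξ φ => (@derivedSet X (𝔛.topology ξ) (𝔛.eval V φ)ᶜ)ᶜ

/-- A formula is valid on an ambiance if it is true everywhere under all valuations with values in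
the algebra. -/
def Ambiance.Valid {Λ : Ordinal.{u}} {X : Type v} (𝔛 : Ambiance Λ X) (φ : Formula Λ) : Prop :=
  ∀ V : ℕ → Set X, (∀ n, V n ∈ 𝔛.algebra) → 𝔛.eval V φ = Set.univ

/-- `GLP_Λ` is complete for a class of ambiances if it proves every formula valid on all of them. -/
def GLPCompleteFor {Λ : Ordinal.{u}} {X : Type v} (C : Set (Ambiance Λ X)) : Prop :=
  ∀ φ : Formula Λ, (∀ 𝔛 ∈ C, 𝔛.Valid φ) → GLP Λ φ

/-- Scattered spaces: every nonempty subset has an isolated point. -/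
def IsScattered {X : Type v} (T : TopologicalSpace X) : Prop :=
  ∀ A : Set X, A.Nonempty → ∃ x ∈ A, ∃ U, IsOpen[T] U ∧ U ∩ A = {x}

/-- `T'` extends `T`, that is, every `T`-open set is `T'`-open. -/
def Refines {X : Type v} (T T' : TopologicalSpace X) : Prop :=
  ∀ U : Set X, IsOpen[T] U → IsOpen[T'] U

/-- Provability ambiances. -/
structure Ambiance.IsProvability {Λ : Ordinal.{u}} {X : Type v} (𝔛 : Ambiance Λ X) : Prop where
  scattered : ∀ ξ, IsScattered (𝔛.topology ξ)
  increasing : ∀ ξ ζ, ξ ≤ ζ → Refines (𝔛.topology ξ) (𝔛.topology ζ)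
  derivedSet_isOpen : ∀ ξ ζ, ξ < ζ → ∀ S ∈ 𝔛.algebra,
    IsOpen[𝔛.topology ζ] (@derivedSet X (𝔛.topology ξ) S)

/-! ### Icard ambiances -/

/-- The Icard topology `I_ξ` on the ordinal `Θ`. -/
def icardTopology (Θ ξ : Ordinal.{u}) : TopologicalSpace (Iio Θ) :=
  if ξ = 0 then Topology.lowerSet (Iio Θ)
  else TopologicalSpace.generateFrom {U | ∃ η < ξ, ∃ β ≤ Θ,
    U = {ϑ : Iio Θ | hyperlog η ϑ ≤ β} ∨
    ∃ α < β, U = {ϑ : Iio Θ | α < hyperlog η ϑ ∧ hyperlog η ϑ ≤ β}}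

/-- Icard `Λ`-ambiances on `Θ`: provability ambiances with topologies `I_ξ`, `ξ < Λ`. -/
def icardAmbiances (Λ Θ : Ordinal.{u}) : Set (Ambiance Λ (Iio Θ)) :=
  {𝔛 | 𝔛.IsProvability ∧ ∀ ξ : Iio Λ, 𝔛.topology ξ = icardTopology Θ ξ}

/-- Shifted Icard `Λ`-ambiances on `Θ`: provability ambiances with topologies `I_(1 + ξ)`,
`ξ < Λ`. -/
def shiftedIcardAmbiances (Λ Θ : Ordinal.{u}) : Set (Ambiance Λ (Iio Θ)) :=
  {𝔛 | 𝔛.IsProvability ∧ ∀ ξ : Iio Λ, 𝔛.topology ξ = icardTopology Θ (1 + ξ)}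

/-! ### Beklemishev-Gabelaia spaces -/

/-- Transfinite iterates of the derived set operator. -/
def iterDerivedSet {X : Type v} (T : TopologicalSpace X) (A : Set X) (ξ : Ordinal.{v}) : Set X :=
  limitRecOn ξ A (fun _ B ↦ @derivedSet X T B) (fun ξ _ B ↦ ⋂ η, ⋂ h : η < ξ, B η h)

/-- The rank of a point of a scattered space. -/
def rank {X : Type v} (T : TopologicalSpace X) (x : X) : Ordinal.{v} :=
  sInf {α | x ∉ iterDerivedSet T Set.univ (α + 1)}

/-- `T'` is a limit-refinement of `T`: it has the same ranks, and at points of non-limit rank it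
has the same neighbourhoods. -/
structure IsLimitRefinement {X : Type v} (T T' : TopologicalSpace X) : Prop where
  refines : Refines T T'
  rank_eq : rank T = rank T'
  nhds : ∀ x, ¬ Order.IsSuccLimit (rank T x) → ∀ U, IsOpen[T'] U → x ∈ U →
    ∃ V, IsOpen[T] V ∧ x ∈ V ∧ V ⊆ U

/-- `T'` is a limit-maximal refinement of `T`: no limit-refinement of `T` properly refines it. -/
structure IsLimitMaximalRefinement {X : Type v} (T T' : TopologicalSpace X) : Prop where
  isLimitRefinement : IsLimitRefinement T T'
  maximal : ∀ T'' : TopologicalSpace X, IsLimitRefinement T T'' → Refines T' T'' → T'' = T'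

/-- The interval topology on `Θ`. -/
def intervalTopology (Θ : Ordinal.{u}) : TopologicalSpace (Iio Θ) :=
  TopologicalSpace.generateFrom {U | ∃ β, U = Iic β ∨ ∃ α, U = Ioc α β}

/-- The topology generated by the open sets and the derived sets of arbitrary sets. -/
def plusTopology {X : Type v} (T : TopologicalSpace X) : TopologicalSpace X :=
  TopologicalSpace.generateFrom ({U | IsOpen[T] U} ∪ {U | ∃ S, U = @derivedSet X T S})

/-- The join of the topologies with index below `ξ`. -/
def joinTopology {Λ : Ordinal.{u}} {X : Type v} (T : Iio Λ → TopologicalSpace X) (ξ : Iio Λ) :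
    TopologicalSpace X :=
  TopologicalSpace.generateFrom {U | ∃ ζ < ξ, IsOpen[T ζ] U}

/-- Beklemishev-Gabelaia polytopologies on `Θ`. -/
structure IsBGPolytopology {Λ Θ : Ordinal.{u}} (T : Iio Λ → TopologicalSpace (Iio Θ)) : Prop where
  zero : ∀ ξ : Iio Λ, (ξ : Ordinal.{u}) = 0 → IsLimitMaximalRefinement (intervalTopology Θ) (T ξ)
  add_one : ∀ ζ ξ : Iio Λ, (ξ : Ordinal.{u}) = ζ + 1 →
    IsLimitMaximalRefinement (plusTopology (T ζ)) (T ξ)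
  limit : ∀ ξ : Iio Λ, Order.IsSuccLimit (ξ : Ordinal.{u}) →
    IsLimitMaximalRefinement (joinTopology T ξ) (T ξ)

/-- BG-spaces on `Θ` as ambiances: all subsets of `Θ` are admitted as truth values. -/
def bgSpaces (Λ Θ : Ordinal.{u}) : Set (Ambiance Λ (Iio Θ)) :=
  {𝔛 | IsBGPolytopology 𝔛.topology ∧ 𝔛.algebra = Set.univ}

end

end PolyGLP

namespace PolyGLP

open Ordinal Set Filter
open scoped Topology

noncomputable section

theorem exists_endLog_lt {z : Ordinal.{u}} (h : z ≠ 0) :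
    ∃ a < z, ∀ w, a < w → w < z → endLog w < endLog z := by
  obtain ⟨α, β, rfl⟩ := exists_eq_add_opow h
  refine ⟨α, lt_add_of_pos_right α (opow_pos β omega0_pos), fun w h1 h2 ↦ ?_⟩
  obtain ⟨w, rfl⟩ := exists_add_of_le h1.le
  have hw : w ≠ 0 := by rintro rfl; simp at h1
  have h3 := (add_lt_add_iff_left α).1 h2
  rw [endLog_add _ hw, endLog_add_opow]
  obtain ⟨a, b, rfl⟩ := exists_eq_add_opow hw
  rw [endLog_add_opow]
  exact (opow_lt_opow_iff_right one_lt_omega0).1 (le_add_self.trans_lt h3)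

theorem hyperexp_apply_zero (ζ : Ordinal.{u}) : hyperexp ζ 0 = 0 := by
  by_contra h
  exact not_lt_bot (hyperlog_lt ζ 0 0 (pos_iff_ne_zero.2 h))

theorem hyperexp_add_apply (α β x : Ordinal.{u}) :
    hyperexp (α + β) x = hyperexp α (hyperexp β x) :=
  congrFun (hyperexp_family.add α β) x

theorem hyperexp_one_one : hyperexp 1 1 = ω := by
  rw [hyperexp_family.one, expBase_of_pos one_ne_zero, opow_one]

theorem add_one_lt_hyperexp {t ϑ : Ordinal.{u}} (h : t < hyperexp ϑ 1) :
    t + 1 < hyperexp (ϑ + 1) 1 := by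
  rw [hyperexp_add_apply, hyperexp_one_one]
  exact (Order.add_one_le_of_lt h).trans_lt
    ((hyperexp_family.normal ϑ).strictMono one_lt_omega0)

theorem exists_lt_hyperexp_opow {β t : Ordinal.{u}} (hβ : β ≠ 0) (h : t < hyperexp (ω ^ β) 1) :
    ∃ ϑ < ω ^ β, t < hyperexp ϑ 1 := by
  induction t using WellFoundedLT.induction with
  | ind s ih =>
    by_contra! hs
    have hlim := isSuccLimit_omega0_opow hβ
    have hs0 : s ≠ 0 := by
      rintro rfl
      have := hs 0 (opow_pos β omega0_pos)
      simp [hyperexp_zero] at this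
    have hsl : Order.IsSuccLimit s := by
      rcases zero_or_succ_or_isSuccLimit s with h0 | ⟨t, rfl⟩ | h0
      · exact absurd h0 hs0
      · rw [Order.succ_eq_add_one] at h hs
        have hlt : t < t + 1 := Order.lt_add_one_iff.2 le_rfl
        obtain ⟨ϑ, hϑ, h1⟩ := ih t (by simp) (hlt.trans h)
        exact absurd (add_one_lt_hyperexp h1) (hs _ (hlim.add_one_lt hϑ)).not_gt
      · exact h0
    obtain ⟨γ, hγ⟩ := range_hyperexp_opow (ν := s) hβ fun σ hσ ↦ by
      by_contra! hlt
      obtain ⟨t, ht, h1⟩ := ((hyperexp_family.normal _).lt_iff_exists_lt hsl).1 hlt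
      obtain ⟨ϑ, hϑ, h2⟩ := ih t ht (ht.trans h)
      have hσ' := (opow_lt_opow_iff_right one_lt_omega0).2 hσ
      have h3 := hs _ (isPrincipal_add_omega0_opow β hσ' hϑ)
      rw [hyperexp_add_apply] at h3
      exact (h1.trans ((hyperexp_family.normal _).strictMono h2)).not_ge h3
    have hγ0 : γ ≠ 0 := by
      rintro rfl
      exact hs0 (by rw [← hγ, hyperexp_apply_zero])
    have := (hyperexp_family.normal (ω ^ β)).monotone (Order.one_le_iff_pos.2 <| pos_iff_ne_zero.2 hγ0)
    rw [hγ] at this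
    exact this.not_gt h

theorem exists_lt_hyperexp_of_isSuccLimit {ζ t : Ordinal.{u}} (hζ : Order.IsSuccLimit ζ)
    (h : t < hyperexp ζ 1) : ∃ ϑ < ζ, t < hyperexp ϑ 1 := by
  obtain ⟨α, β, rfl⟩ := exists_eq_add_opow hζ.ne_bot
  have hβ : β ≠ 0 := by
    rintro rfl
    rw [opow_zero] at hζ
    exact (lt_irrefl _ (hζ.add_one_lt (Order.lt_add_one_iff.2 le_rfl : α < α + 1)))
  rw [hyperexp_add_apply] at h
  have hlim := isSuccLimit_omega0_opow hβ
  have hl : Order.IsSuccLimit (hyperexp (ω ^ β) 1) := by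
    rw [Ordinal.isSuccLimit_iff, Order.isSuccPrelimit_iff_succ_lt]
    refine ⟨?_, fun t ht ↦ ?_⟩
    · rw [← hyperexp_apply_zero (ω ^ β)]
      exact ((hyperexp_family.normal _).strictMono zero_lt_one).ne'
    · obtain ⟨ϑ, hϑ, h1⟩ := exists_lt_hyperexp_opow hβ ht
      rw [Order.succ_eq_add_one]
      refine (add_one_lt_hyperexp h1).trans_le ?_
      have h2 := hyperexp_add_apply (ϑ + 1) (ω ^ β) 1
      rw [add_omega0_opow (hlim.add_one_lt hϑ)] at h2
      rw [h2]
      refine (hyperexp_family.normal _).monotone (Order.one_le_iff_pos.2 ?_)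
      rw [← hyperexp_apply_zero (ω ^ β)]
      exact (hyperexp_family.normal _).strictMono zero_lt_one
  obtain ⟨t', ht', h1⟩ := ((hyperexp_family.normal α).lt_iff_exists_lt hl).1 h
  obtain ⟨ϑ, hϑ, h2⟩ := exists_lt_hyperexp_opow hβ ht'
  refine ⟨α + ϑ, (add_lt_add_iff_left α).2 hϑ, ?_⟩
  rw [hyperexp_add_apply]
  exact h1.trans ((hyperexp_family.normal α).strictMono h2)

theorem exists_lt_hyperexp_natCast {Λ Θ : Ordinal.{u}} (hΛ : 0 < Λ) (hΘ : Θ < hyperexp (1 + Λ) 1) :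
    ∃ ξ < Λ, ∃ n : ℕ, Θ < hyperexp (1 + ξ) n := by
  rcases zero_or_succ_or_isSuccLimit Λ with h0 | ⟨ξ, rfl⟩ | hl
  · exact absurd h0 hΛ.ne'
  · rw [Order.succ_eq_add_one] at hΘ ⊢
    refine ⟨ξ, Order.lt_add_one_iff.2 le_rfl, ?_⟩
    rw [← add_assoc, hyperexp_add_apply, hyperexp_one_one] at hΘ
    obtain ⟨m, hm, h⟩ := ((hyperexp_family.normal _).lt_iff_exists_lt isSuccLimit_omega0).1 hΘ
    obtain ⟨n, rfl⟩ := lt_omega0.1 hm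
    exact ⟨n, h⟩
  · obtain ⟨ϑ, hϑ, h⟩ := exists_lt_hyperexp_of_isSuccLimit (isSuccLimit_add 1 hl) hΘ
    rcases eq_or_ne ϑ 0 with rfl | h0
    · refine ⟨0, hΛ, 1, ?_⟩
      rw [add_zero, Nat.cast_one, hyperexp_one_one]
      rw [hyperexp_zero] at h
      exact h.trans one_lt_omega0
    · obtain ⟨ξ, rfl⟩ := exists_add_of_le (Order.one_le_iff_pos.2 <| pos_iff_ne_zero.2 h0)
      exact ⟨ξ, (add_lt_add_iff_left 1).1 hϑ, 1, by simpa using h⟩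

/-! ### Strict bounds -/

/-- `r` decreases strictly on a punctured neighbourhood of every point. -/
def IsStrictBound {X : Type v} (T : TopologicalSpace X) (r : X → Ordinal.{u}) : Prop :=
  ∀ x, ∃ U, IsOpen[T] U ∧ x ∈ U ∧ ∀ y ∈ U, y ≠ x → r y < r x

theorem mem_derivedSet_iff {X : Type v} (T : TopologicalSpace X) {S : Set X} {x : X} :
    x ∈ @derivedSet X T S ↔ ∀ U, IsOpen[T] U → x ∈ U → ∃ y ∈ U, y ≠ x ∧ y ∈ S := by
  let := T
  rw [mem_derivedSet, accPt_iff_nhds]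
  constructor
  · intro h U hU hx
    obtain ⟨y, ⟨h1, h2⟩, h3⟩ := h U (hU.mem_nhds hx)
    exact ⟨y, h1, h3, h2⟩
  · intro h U hU
    obtain ⟨W, hW, hWo, hx⟩ := mem_nhds_iff.1 hU
    obtain ⟨y, h1, h2, h3⟩ := h W hWo hx
    exact ⟨y, ⟨hW h1, h3⟩, h2⟩

theorem IsStrictBound.mono {X : Type v} {T T' : TopologicalSpace X} (h : Refines T T')
    {r : X → Ordinal.{u}} (hr : IsStrictBound T r) : IsStrictBound T' r := fun x ↦ by
  obtain ⟨U, hU, hx⟩ := hr x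
  exact ⟨U, h U hU, hx⟩

/-- The pointwise infimum of all strict bounds. -/
def leastBound {X : Type v} (T : TopologicalSpace X) (x : X) : Ordinal.{u} :=
  sInf {a | ∃ s : X → Ordinal.{u}, IsStrictBound T s ∧ s x = a}

theorem leastBound_le {X : Type v} {T : TopologicalSpace X} {s : X → Ordinal.{u}}
    (hs : IsStrictBound T s) (x : X) : leastBound T x ≤ s x :=
  csInf_le' ⟨s, hs, rfl⟩

theorem isStrictBound_leastBound {X : Type v} {T : TopologicalSpace X} {s : X → Ordinal.{u}}
    (hs : IsStrictBound T s) : IsStrictBound T (leastBound.{u} T) := fun x ↦ by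
  obtain ⟨t, ht, h⟩ := csInf_mem
    (s := {a | ∃ s : X → Ordinal.{u}, IsStrictBound T s ∧ s x = a}) ⟨_, s, hs, rfl⟩
  obtain ⟨U, hU, hx, h1⟩ := ht x
  refine ⟨U, hU, hx, fun y hy hne ↦ (leastBound_le ht y).trans_lt ((h1 y hy hne).trans_eq h)⟩

theorem IsStrictBound.isOpen_le {X : Type v} {T : TopologicalSpace X} {r : X → Ordinal.{u}}
    (hr : IsStrictBound T r) (a : Ordinal.{u}) : IsOpen[T] {x | r x ≤ a} := by
  let := T
  refine isOpen_iff_mem_nhds.2 fun x hx ↦ ?_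
  obtain ⟨U, hU, hxU, h⟩ := hr x
  refine mem_of_superset (IsOpen.mem_nhds hU hxU) fun y hy ↦ ?_
  rcases eq_or_ne y x with rfl | hne
  · exact hx
  · exact (h y hy hne).le.trans hx

theorem setOf_lt_leastBound {X : Type v} {T : TopologicalSpace X} {s : X → Ordinal.{u}}
    (hs : IsStrictBound T s) (a : Ordinal.{u}) :
    {x | a < leastBound.{u} T x} = @derivedSet X T {x | a ≤ leastBound.{u} T x} := by
  have hr := isStrictBound_leastBound hs
  ext x
  rw [mem_derivedSet_iff]
  constructor
  · intro hx
    by_contra! h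
    obtain ⟨U, hU, hxU, h⟩ := h
    classical
    have hle : ∀ y, Function.update (leastBound.{u} T) x a y ≤ leastBound T y := fun y ↦ by
      rcases eq_or_ne y x with rfl | hne
      · simpa using le_of_lt hx
      · simp [hne]
    have h1 : IsStrictBound T (Function.update (leastBound.{u} T) x a) := fun z ↦ by
      rcases eq_or_ne z x with rfl | hz
      · refine ⟨U, hU, hxU, fun y hy hne ↦ ?_⟩
        have := h y hy hne
        simpa [hne] using this
      · obtain ⟨W, hW, hzW, h2⟩ := hr z
        refine ⟨W, hW, hzW, fun y hy hne ↦ (hle y).trans_lt ?_⟩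
        simpa [hz] using h2 y hy hne
    have h2 := leastBound_le h1 x
    rw [Function.update_self] at h2
    exact h2.not_gt hx
  · intro h
    obtain ⟨U, hU, hx, h1⟩ := hr x
    obtain ⟨y, hy, hne, h2⟩ := h U hU hx
    exact lt_of_le_of_lt h2 (h1 y hy hne)

theorem isStrictBound_endLog {X : Type v} {T T' : TopologicalSpace X} (h : Refines T T')
    {r : X → Ordinal.{u}} (hr : IsStrictBound T r)
    (ho : ∀ x, ∀ a < r x, IsOpen[T'] {y | a < r y ∧ r y ≤ r x}) :
    IsStrictBound T' (endLog ∘ r) := fun x ↦ by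
  let := T'
  obtain ⟨U, hU, hx, hlt⟩ := hr x
  rcases eq_or_ne (r x) 0 with h0 | h0
  · refine ⟨U, h U hU, hx, fun y hy hne ↦ absurd (hlt y hy hne) ?_⟩
    simp [h0]
  · obtain ⟨a, ha, hend⟩ := exists_endLog_lt h0
    exact ⟨U ∩ {y | a < r y ∧ r y ≤ r x}, (h U hU).inter (ho x a ha), ⟨hx, ha, le_rfl⟩,
      fun y hy hne ↦ hend _ hy.2.1 (hlt y hy.1 hne)⟩

theorem leastBound_plus_le {X : Type v} {T T' : TopologicalSpace X}
    (h : Refines (plusTopology T) T') {s : X → Ordinal.{u}} (hs : IsStrictBound T s) (x : X) :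
    leastBound.{u} T' x ≤ endLog (leastBound T x) := by
  have hT : Refines T T' := fun U hU ↦ h U (.basic _ (.inl hU))
  have hle := fun b ↦ hT _ ((isStrictBound_leastBound hs).isOpen_le b)
  refine leastBound_le (isStrictBound_endLog hT (isStrictBound_leastBound hs)
    fun y a _ ↦ ?_) x
  exact @IsOpen.inter _ T' {z | a < leastBound T z} {z | leastBound T z ≤ leastBound T y} (h _ (.basic _ (.inr ⟨_, setOf_lt_leastBound hs a⟩)))
      (hle _)

theorem leastBound_lt_of_lt_hyperexp {X : Type v} (T : Ordinal.{u} → TopologicalSpace X)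
    (hmono : ∀ ξ ζ, ξ ≤ ζ → Refines (T ξ) (T ζ))
    (hplus : ∀ ξ, Refines (plusTopology (T ξ)) (T (ξ + 1)))
    {s : X → Ordinal.{u}} (hs : IsStrictBound (T 0) s) (ζ : Ordinal.{u}) :
    ∀ α x γ, leastBound (T α) x < hyperexp ζ γ → leastBound (T (α + ζ)) x < γ := by
  have hs' : ∀ α, IsStrictBound (T α) s := fun α ↦ hs.mono (hmono _ _ bot_le)
  refine opow_induction (P := fun ζ ↦ ∀ α x γ, leastBound (T α) x < hyperexp ζ γ →
    leastBound (T (α + ζ)) x < γ) ?_ ?_ ?_ ζ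
  · intro α x γ h
    simpa [hyperexp_zero] using h
  · intro ρ ih α
    rcases eq_or_ne ρ 0 with rfl | h0
    · intro x γ h
      rw [opow_zero] at h ⊢
      refine (leastBound_plus_le (hplus α) (hs' α) x).trans_lt ?_
      rw [← hyperlog_one]
      exact hyperlog_lt _ _ _ h
    have hmin : ∀ x, ∃ μ, ∃ ϑ < ω ^ ρ, hyperexp (ω ^ ρ) μ = leastBound (T (α + ϑ)) x ∧
        ∀ η < ω ^ ρ, hyperexp (ω ^ ρ) μ ≤ leastBound (T (α + η)) x := by
      intro x
      obtain ⟨_, ⟨ϑ, hϑ, rfl⟩, hmin⟩ := WellFounded.has_min (wellFounded_lt (α := Ordinal.{u}))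
        ((fun ϑ ↦ leastBound (T (α + ϑ)) x) '' Iio (ω ^ ρ)) ⟨_, 0, opow_pos ρ omega0_pos, rfl⟩
      obtain ⟨γ, hγ⟩ := range_hyperexp_opow (ν := leastBound (T (α + ϑ)) x) h0 fun σ hσ ↦ by
        by_contra! hlt
        have hσ' := (opow_lt_opow_iff_right one_lt_omega0).2 hσ
        have h1 := ih _ hσ' _ _ _ hlt
        rw [add_assoc] at h1
        exact hmin _ ⟨ϑ + ω ^ σ, isPrincipal_add_omega0_opow ρ hϑ hσ', rfl⟩ h1
      exact ⟨γ, ϑ, hϑ, hγ, fun η hη ↦ hγ.trans_le (le_of_not_gt (hmin _ ⟨η, hη, rfl⟩))⟩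
    choose μ ϑ hϑ hμ hle using hmin
    have hbound : IsStrictBound (T (α + ω ^ ρ)) μ := fun x ↦ by
      obtain ⟨U, hU, hx, hlt⟩ := isStrictBound_leastBound (hs' (α + ϑ x)) x
      refine ⟨U, hmono _ _ ((add_le_add_iff_left α).2 (hϑ x).le) U hU, hx, fun y hy hne ↦ ?_⟩
      refine (hyperexp_family.normal (ω ^ ρ)).strictMono.lt_iff_lt.1 ?_
      exact (hle y _ (hϑ x)).trans_lt ((hlt y hy hne).trans_eq (hμ x).symm)
    intro x γ h
    refine (leastBound_le hbound x).trans_lt ?_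
    have := hle x 0 (opow_pos ρ omega0_pos)
    rw [add_zero] at this
    exact (hyperexp_family.normal (ω ^ ρ)).strictMono.lt_iff_lt.1 (this.trans_lt h)
  · intro β β' h h' α x γ hlt
    rw [hyperexp_add_apply] at hlt
    rw [← add_assoc]
    exact h' _ _ _ (h _ _ _ hlt)

/-! ### Heights -/

/-- The formula `[ξ] ⋯ [ξ] ⊥` with `n` boxes. -/
def Formula.boxIterBot {Λ : Ordinal.{u}} (ξ : Iio Λ) : ℕ → Formula Λ
  | 0 => .neg .top
  | n + 1 => .box ξ (boxIterBot ξ n)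

theorem valid_boxIterBot {Λ : Ordinal.{u}} {X : Type v} (𝔛 : Ambiance Λ X) (ξ : Iio Λ)
    {r : X → Ordinal.{u}} (hr : IsStrictBound (𝔛.topology ξ) r) {n : ℕ} (hn : ∀ x, r x < n) :
    𝔛.Valid (.boxIterBot ξ n) := by
  intro V _
  have key : ∀ m : ℕ, ∀ x, r x < m → x ∈ 𝔛.eval V (.boxIterBot ξ m) := by
    intro m
    induction m with
    | zero => intro x hx; exact absurd hx (by simp)
    | succ m ih =>
      intro x hx hd
      rw [Nat.cast_succ, Order.lt_add_one_iff] at hx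
      obtain ⟨U, hU, hxU, hlt⟩ := hr x
      obtain ⟨y, hy, hne, hy'⟩ := (mem_derivedSet_iff _).1 hd U hU hxU
      exact hy' (ih y ((hlt y hy hne).trans_le hx))
  exact eq_univ_of_forall fun x ↦ key n x (hn x)

/-! ### The classes of ambiances -/

theorem isStrictBound_interval (Θ : Ordinal.{u}) :
    IsStrictBound (intervalTopology Θ) fun x ↦ endLog x := fun x ↦ by
  rcases eq_or_ne (x : Ordinal.{u}) 0 with h0 | h0
  · refine ⟨Iic x, .basic _ ⟨x, .inl rfl⟩, mem_Iic.2 le_rfl, fun y hy hne ↦ ?_⟩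
    have : (y : Ordinal.{u}) ≤ 0 := h0 ▸ hy
    exact absurd (Subtype.ext ((le_zero_iff.1 this).trans h0.symm)) hne
  · obtain ⟨a, ha, hend⟩ := exists_endLog_lt h0
    refine ⟨Ioc ⟨a, ha.trans x.2⟩ x, .basic _ ⟨x, .inr ⟨_, rfl⟩⟩, ⟨ha, le_rfl⟩, fun y hy hne ↦ ?_⟩
    exact hend y hy.1 (lt_of_le_of_ne hy.2 (Subtype.coe_injective.ne hne))

theorem refines_refl {X : Type v} (T : TopologicalSpace X) : Refines T T := fun _ h ↦ h

theorem refines_bot {X : Type v} (T : TopologicalSpace X) : Refines T ⊥ := fun U _ ↦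
  @isOpen_discrete X ⊥ (@DiscreteTopology.mk X ⊥ rfl) U

theorem IsBGPolytopology.refines {Λ Θ : Ordinal.{u}} {T : Iio Λ → TopologicalSpace (Iio Θ)}
    (hT : IsBGPolytopology T) (ξ : Iio Λ) : ∀ ζ : Iio Λ, ξ ≤ ζ → Refines (T ξ) (T ζ) := by
  rintro ⟨ζ, hζ⟩
  induction ζ using WellFoundedLT.induction with
  | ind ζ ih =>
    intro h
    rcases h.eq_or_lt with rfl | h
    · exact refines_refl _
    rcases zero_or_succ_or_isSuccLimit ζ with rfl | ⟨η, rfl⟩ | hl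
    · exact absurd (show (ξ : Ordinal.{u}) < 0 from h) not_lt_bot
    · have h1 : (ξ : Ordinal.{u}) ≤ η := Order.lt_succ_iff.1 h
      have hη := Order.lt_succ η
      intro U hU
      exact (hT.add_one ⟨η, hη.trans hζ⟩ ⟨_, hζ⟩ (Order.succ_eq_add_one _)).isLimitRefinement.refines
        U (.basic _ (.inl (ih η hη (hη.trans hζ) h1 U hU)))
    · intro U hU
      exact (hT.limit ⟨ζ, hζ⟩ hl).isLimitRefinement.refines U (.basic _ ⟨ξ, h, hU⟩)

theorem bgSpaces_valid {Λ Θ : Ordinal.{u}} {ξ : Iio Λ} {n : ℕ} (hΘ : Θ < hyperexp (1 + ξ) n)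
    {𝔛 : Ambiance Λ (Iio Θ)} (h : 𝔛 ∈ bgSpaces Λ Θ) : 𝔛.Valid (.boxIterBot ξ n) := by
  obtain ⟨hT, -⟩ := h
  set T : Ordinal.{u} → TopologicalSpace (Iio Θ) := fun ζ ↦
    if h : ζ < Λ then 𝔛.topology ⟨ζ, h⟩ else ⊥ with hTdef
  have hΛ : 0 < Λ := bot_le.trans_lt ξ.2
  have hT0 : Refines (intervalTopology Θ) (T 0) := by
    simp only [hTdef, dif_pos hΛ]
    exact (hT.zero ⟨0, hΛ⟩ rfl).isLimitRefinement.refines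
  have hmono : ∀ ξ ζ, ξ ≤ ζ → Refines (T ξ) (T ζ) := by
    intro ξ ζ hle
    by_cases hζ : ζ < Λ
    · simp only [hTdef, dif_pos hζ, dif_pos (hle.trans_lt hζ)]
      exact hT.refines _ _ hle
    · simp only [hTdef, dif_neg hζ]
      exact refines_bot _
  have hplus : ∀ ξ, Refines (plusTopology (T ξ)) (T (ξ + 1)) := by
    intro ξ
    by_cases hξ : ξ + 1 < Λ
    · have hξ' : ξ < Λ := (Order.lt_add_one_iff.2 le_rfl).trans hξ
      simp only [hTdef, dif_pos hξ, dif_pos hξ']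
      exact (hT.add_one ⟨ξ, hξ'⟩ ⟨_, hξ⟩ rfl).isLimitRefinement.refines
    · simp only [hTdef, dif_neg hξ]
      exact refines_bot _
  have hs := (isStrictBound_interval Θ).mono hT0
  have hTξ : T ξ = 𝔛.topology ξ := dif_pos ξ.2
  have hb := isStrictBound_leastBound (hs.mono (hmono 0 ξ bot_le))
  rw [hTξ] at hb
  refine valid_boxIterBot 𝔛 ξ hb fun x ↦ ?_
  have := leastBound_lt_of_lt_hyperexp T hmono hplus hs ξ 0 x n ?_
  · rwa [zero_add, hTξ] at this
  · refine (leastBound_le hs x).trans_lt ?_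
    rw [hyperexp_add_apply] at hΘ
    have := hyperlog_lt 1 _ _ ((show (x : Ordinal.{u}) < Θ from x.2).trans hΘ)
    rwa [hyperlog_one] at this

theorem refines_icardTopology (Θ : Ordinal.{u}) {ξ ζ : Ordinal.{u}} (h : ξ ≤ ζ) :
    Refines (icardTopology Θ ξ) (icardTopology Θ ζ) := by
  rcases eq_or_ne ζ 0 with rfl | hζ
  · rw [le_zero_iff.1 h]; exact refines_refl _
  rcases eq_or_ne ξ 0 with rfl | hξ
  · intro U hU
    rw [icardTopology, if_pos rfl] at hU
    have hU' : IsLowerSet U := hU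
    rw [icardTopology, if_neg hζ]
    have : U = ⋃₀ {W | ∃ x ∈ U, W = {ϑ : Iio Θ | hyperlog 0 ϑ ≤ x}} := by
      ext y
      constructor
      · intro hy
        exact ⟨_, ⟨y, hy, rfl⟩, by simp [hyperlog_zero]⟩
      · rintro ⟨_, ⟨x, hx, rfl⟩, hy⟩
        refine hU' (a := x) ?_ hx
        simpa [hyperlog_zero] using hy
    rw [this]
    refine TopologicalSpace.GenerateOpen.sUnion _ ?_
    rintro _ ⟨x, -, rfl⟩
    exact .basic _ ⟨0, pos_iff_ne_zero.2 hζ, x, le_of_lt x.2, .inl rfl⟩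
  · intro U hU
    rw [icardTopology, if_neg hξ] at hU
    rw [icardTopology, if_neg hζ]
    refine TopologicalSpace.le_generateFrom_iff_subset_isOpen.2 ?_ _ hU
    rintro _ ⟨η, hη, β, hβ, h1⟩
    exact .basic _ ⟨η, hη.trans_le h, β, hβ, h1⟩

theorem isStrictBound_hyperlog (Θ ξ : Ordinal.{u}) :
    IsStrictBound (icardTopology Θ ξ) fun x ↦ hyperlog ξ x := by
  induction ξ using WellFoundedLT.induction with
  | ind ξ ih =>
    rcases zero_or_succ_or_isSuccLimit ξ with rfl | ⟨η, rfl⟩ | hl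
    · intro x
      refine ⟨Iic x, ?_, mem_Iic.2 le_rfl, fun y hy hne ↦ ?_⟩
      · rw [icardTopology, if_pos rfl]
        exact isLowerSet_Iic x
      · rw [hyperlog_zero]
        exact lt_of_le_of_ne hy (Subtype.coe_injective.ne hne)
    · have hη := Order.lt_succ η
      have hle : ∀ x : Iio Θ, hyperlog η x ≤ Θ := fun x ↦ by
        have h0 : hyperlog η x ≤ hyperlog 0 x := hyperlog_antitone x bot_le
        rw [hyperlog_zero] at h0
        exact h0.trans (le_of_lt x.2)
      have h0 : Order.succ η ≠ 0 := (bot_le.trans_lt hη).ne'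
      have := isStrictBound_endLog (refines_icardTopology Θ hη.le) (ih η hη)
        fun x a ha ↦ ?_
      · rw [Order.succ_eq_add_one] at this ⊢
        rw [hyperlog_add_one]
        exact this
      · rw [icardTopology, if_neg h0]
        exact .basic _ ⟨η, hη, _, hle x, .inr ⟨a, ha, rfl⟩⟩
    · intro x
      obtain ⟨α, ρ, rfl⟩ := exists_eq_add_opow hl.ne_bot
      have hρ : ρ ≠ 0 := by
        rintro rfl
        rw [opow_zero] at hl
        exact (lt_irrefl _ (hl.add_one_lt (Order.lt_add_one_iff.2 le_rfl : α < α + 1)))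
      obtain ⟨ϑ, hϑ, h⟩ := hyperlog_eventually_aux hρ (fun ϑ _ ↦ hyperlog_lt ϑ) (hyperlog α x)
      have hlt := (add_lt_add_iff_left α).2 hϑ
      obtain ⟨U, hU, hx, h1⟩ := ih _ hlt x
      refine ⟨U, refines_icardTopology Θ hlt.le U hU, hx, fun y hy hne ↦ ?_⟩
      have h2 : hyperlog (α + ϑ) y < hyperlog (α + ϑ) x := h1 y hy hne
      have h3 : hyperlog (α + ω ^ ρ) = hyperlog (ω ^ ρ) ∘ hyperlog (α + ϑ) := by
        rw [← hyperlog_add, add_assoc, add_omega0_opow hϑ]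
      have h4 : hyperlog (α + ϑ) x = hyperexp (ω ^ ρ) (hyperlog (α + ω ^ ρ) x) := by
        rw [hyperlog_add, hyperlog_add]
        exact h
      change hyperlog (α + ω ^ ρ) y < hyperlog (α + ω ^ ρ) x
      rw [h4] at h2
      rw [h3]
      rw [h3] at h2
      exact hyperlog_lt _ _ _ h2

theorem shiftedIcardAmbiances_valid {Λ Θ : Ordinal.{u}} {ξ : Iio Λ} {n : ℕ}
    (hΘ : Θ < hyperexp (1 + ξ) n) {𝔛 : Ambiance Λ (Iio Θ)}
    (h : 𝔛 ∈ shiftedIcardAmbiances Λ Θ) : 𝔛.Valid (.boxIterBot ξ n) := by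
  have hb := isStrictBound_hyperlog Θ (1 + ξ)
  rw [← h.2 ξ] at hb
  exact valid_boxIterBot 𝔛 ξ hb fun x ↦
    hyperlog_lt _ _ _ ((show (x : Ordinal.{u}) < Θ from x.2).trans hΘ)

/-- The linearity axiom for the modality `[ξ]`. -/
def Formula.linearity {Λ : Ordinal.{u}} (ξ : Iio Λ) (φ ψ : Formula Λ) : Formula Λ :=
  .or (.box ξ (.imp (.and (.box ξ φ) φ) ψ)) (.box ξ (.imp (.and (.box ξ ψ) ψ) φ))

theorem icardAmbiances_valid {Λ Θ : Ordinal.{u}} (hΛ : 0 < Λ) (φ ψ : Formula Λ)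
    {𝔛 : Ambiance Λ (Iio Θ)} (h : 𝔛 ∈ icardAmbiances Λ Θ) :
    𝔛.Valid (.linearity ⟨0, hΛ⟩ φ ψ) := by
  have hT : 𝔛.topology ⟨0, hΛ⟩ = Topology.lowerSet (Iio Θ) := by
    rw [h.2, icardTopology, if_pos rfl]
  have hd : ∀ S : Set (Iio Θ), @derivedSet _ (𝔛.topology ⟨0, hΛ⟩) S = {x | ∃ y < x, y ∈ S} := by
    intro S
    ext x
    rw [hT, mem_derivedSet_iff]
    constructor
    · intro h
      obtain ⟨y, hy, hne, hS⟩ := h (Iic x) (isLowerSet_Iic x) (mem_Iic.2 le_rfl)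
      exact ⟨y, lt_of_le_of_ne hy hne, hS⟩
    · rintro ⟨y, hy, hS⟩ U hU hx
      have hU' : IsLowerSet U := hU
      exact ⟨y, hU' hy.le hx, hy.ne, hS⟩
  intro V _
  refine eq_univ_of_forall fun x ↦ ?_
  simp only [Formula.linearity, Ambiance.eval, hd]
  by_contra hx
  simp only [mem_union, mem_compl_iff, mem_inter_iff, mem_ofPred_eq, not_or, not_not] at hx
  obtain ⟨⟨y, -, ⟨hy1, hy2⟩, hy3⟩, z, -, ⟨hz1, hz2⟩, hz3⟩ := hx
  push Not at hy1 hz1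
  rcases lt_trichotomy y z with h | rfl | h
  · exact hy3 (hz1 y h)
  · exact hy3 hz2
  · exact hz3 (hy1 z h)

/-! ### A model of `GLP` on the ordinals -/

theorem nhdsLT_zero : 𝓝[<] (0 : Ordinal.{u}) = ⊥ := by
  have : Iio (0 : Ordinal.{u}) = ∅ := Iio_bot
  rw [this, nhdsWithin_empty]

theorem nhdsLT_hasBasis {x : Ordinal.{u}} (h : x ≠ 0) : (𝓝[<] x).HasBasis (· < x) (Ioo · x) :=
  nhdsLT_basis_of_exists_lt ⟨0, pos_iff_ne_zero.2 h⟩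

theorem eventually_nhdsLT_lt (x : Ordinal.{u}) : ∀ᶠ y in 𝓝[<] x, y < x :=
  eventually_mem_nhdsWithin

theorem eventually_nhdsLT_gt {a x : Ordinal.{u}} (h : a < x) : ∀ᶠ y in 𝓝[<] x, a < y :=
  mem_of_superset ((nhdsLT_hasBasis (bot_le.trans_lt h).ne').mem_of_mem h) fun _ h ↦ h.1

theorem eventually_nhdsLT_ne_zero (x : Ordinal.{u}) : ∀ᶠ y in 𝓝[<] x, y ≠ 0 := by
  rcases eq_or_ne x 0 with rfl | h
  · simp
  · exact (eventually_nhdsLT_gt (pos_iff_ne_zero.2 h)).mono fun _ h ↦ h.ne'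

theorem eventually_eventually_nhdsLT {x : Ordinal.{u}} {p : Ordinal.{u} → Prop}
    (h : ∀ᶠ y in 𝓝[<] x, p y) : ∀ᶠ y in 𝓝[<] x, ∀ᶠ z in 𝓝[<] y, p z := by
  rcases eq_or_ne x 0 with rfl | h0
  · simp
  · obtain ⟨a, ha, h⟩ := (nhdsLT_hasBasis h0).mem_iff.1 h
    filter_upwards [eventually_nhdsLT_gt ha, eventually_nhdsLT_lt x] with y h1 h2
    filter_upwards [eventually_nhdsLT_gt h1, eventually_nhdsLT_lt y] with z h3 h4
    exact h ⟨h3, h4.trans h2⟩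

theorem eventually_endLog_lt (x : Ordinal.{u}) : ∀ᶠ y in 𝓝[<] x, endLog y < endLog x := by
  rcases eq_or_ne x 0 with rfl | h0
  · simp
  · obtain ⟨a, ha, h⟩ := exists_endLog_lt h0
    filter_upwards [eventually_nhdsLT_gt ha, eventually_nhdsLT_lt x] with y h1 h2
    exact h y h1 h2

/-- A two-colouring of the ordinals that alternates along successors and omits limits. -/
def parity (x : Ordinal.{u}) : Prop :=
  limitRecOn (motive := fun _ ↦ Prop) x False (fun _ p ↦ ¬ p) (fun _ _ _ ↦ False)

theorem parity_add_one (x : Ordinal.{u}) : parity (x + 1) ↔ ¬ parity x := by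
  rw [parity, limitRecOn_add_one]
  rfl

theorem endLog_add_one (x : Ordinal.{u}) : endLog (x + 1) = 0 := by
  simpa using endLog_add_opow x 0

theorem endLog_of_parity {x : Ordinal.{u}} (h : parity x) : endLog x = 0 := by
  rcases zero_or_succ_or_isSuccLimit x with rfl | ⟨η, rfl⟩ | hl
  · exact endLog_zero
  · rw [Order.succ_eq_add_one, endLog_add_one]
  · rw [parity, limitRecOn_limit _ _ _ _ hl] at h
    exact h.elim

theorem exists_endLog_eq {a c x : Ordinal.{u}} (ha : a < x) (hc : c < endLog x) :
    ∃ y, a < y ∧ y < x ∧ endLog y = c := by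
  obtain ⟨α, β, rfl⟩ := exists_eq_add_opow (bot_le.trans_lt ha).ne'
  rw [endLog_add_opow] at hc
  obtain ⟨m, hm⟩ := exists_add_of_le (le_max_left α a)
  have hlt : α + m < α + ω ^ β :=
    hm ▸ max_lt (lt_add_of_pos_right α (opow_pos β omega0_pos)) ha
  refine ⟨α + m + ω ^ c, ?_, ?_, endLog_add_opow _ _⟩
  · rw [← hm]
    exact (le_max_right α a).trans_lt (lt_add_of_pos_right _ (opow_pos c omega0_pos))
  · rw [add_assoc, add_lt_add_iff_left]
    exact isPrincipal_add_omega0_opow β ((add_lt_add_iff_left α).1 hlt)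
      ((opow_lt_opow_iff_right one_lt_omega0).2 hc)

theorem add_one_lt_of_endLog_pos {a x : Ordinal.{u}} (h : 0 < endLog x) (ha : a < x) :
    a + 1 < x := by
  refine (Order.add_one_le_of_lt ha).lt_of_ne ?_
  rintro rfl
  simp [endLog_add_one] at h

theorem exists_parity {a x : Ordinal.{u}} (h : 0 < endLog x) (ha : a < x) :
    (∃ y, a < y ∧ y < x ∧ endLog y = 0 ∧ parity y) ∧
      ∃ y, a < y ∧ y < x ∧ endLog y = 0 ∧ ¬ parity y := by
  have h1 := add_one_lt_of_endLog_pos h ha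
  have h2 := add_one_lt_of_endLog_pos h h1
  have l1 : a < a + 1 := Order.lt_add_one_iff.2 le_rfl
  have l2 : a + 1 < a + 1 + 1 := Order.lt_add_one_iff.2 le_rfl
  have hp := parity_add_one (a + 1)
  by_cases hq : parity (a + 1)
  · exact ⟨⟨_, l1, h1, endLog_add_one _, hq⟩, _, l1.trans l2, h2, endLog_add_one _,
      fun h ↦ hp.1 h hq⟩
  · exact ⟨⟨_, l1.trans l2, h2, endLog_add_one _, hp.2 hq⟩, _, l1, h1, endLog_add_one _, hq⟩

/-- The punctured neighbourhood filters of the topologies of the model. -/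
def ladder : ℕ → Ordinal.{u} → Filter Ordinal.{u}
  | 0, x => 𝓝[<] x
  | i + 1, x => 𝓝[<] x ⊓ comap endLog (ladder i (endLog x))

/-- The derived set operators of the model. -/
def ladderDeriv (i : ℕ) (S : Set Ordinal.{u}) : Set Ordinal.{u} := {x | ∃ᶠ y in ladder i x, y ∈ S}

theorem ladder_le_nhdsLT (i : ℕ) (x : Ordinal.{u}) : ladder i x ≤ 𝓝[<] x := by
  cases i with
  | zero => exact le_rfl
  | succ i => exact inf_le_left

theorem tendsto_endLog_ladder (i : ℕ) (x : Ordinal.{u}) :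
    Tendsto endLog (ladder (i + 1) x) (ladder i (endLog x)) :=
  tendsto_iff_comap.2 inf_le_right

theorem ladder_succ_le (i : ℕ) : ∀ x : Ordinal.{u}, ladder (i + 1) x ≤ ladder i x := by
  induction i with
  | zero => exact fun x ↦ ladder_le_nhdsLT 1 x
  | succ i ih => exact fun x ↦ inf_le_inf_left _ (comap_mono (ih _))

theorem ladder_anti {i j : ℕ} (h : i ≤ j) (x : Ordinal.{u}) : ladder j x ≤ ladder i x :=
  antitone_nat_of_succ_le (f := fun i ↦ ladder i x) (fun i ↦ ladder_succ_le i x) h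

theorem eventually_ladder_succ {i : ℕ} {x : Ordinal.{u}} {p : Ordinal.{u} → Prop} :
    (∀ᶠ y in ladder (i + 1) x, p y) ↔ ∃ q : Ordinal.{u} → Prop, (∀ᶠ y in 𝓝[<] x, q y) ∧
      ∃ r : Ordinal.{u} → Prop, (∀ᶠ ν in ladder i (endLog x), r ν) ∧
        ∀ y, q y → r (endLog y) → p y := by
  constructor
  · intro h
    obtain ⟨q, hq, t, ⟨r, hr, hrt⟩, hp⟩ := eventually_inf.1 h
    exact ⟨q, hq, r, hr, fun y h1 h2 ↦ hp y ⟨h1, hrt h2⟩⟩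
  · rintro ⟨q, hq, r, hr, hp⟩
    filter_upwards [ladder_le_nhdsLT _ _ hq, (tendsto_endLog_ladder i x).eventually hr] with y h1 h2
    exact hp y h1 h2

theorem eventually_eventually_ladder (i : ℕ) : ∀ {x : Ordinal.{u}} {p : Ordinal.{u} → Prop},
    (∀ᶠ y in ladder i x, p y) → ∀ᶠ y in ladder i x, ∀ᶠ z in ladder i y, p z := by
  induction i with
  | zero => exact eventually_eventually_nhdsLT
  | succ i ih =>
    intro x p h
    obtain ⟨q, hq, r, hr, hp⟩ := eventually_ladder_succ.1 h
    refine eventually_ladder_succ.2 ⟨_, eventually_eventually_nhdsLT hq, _, ih hr, fun y h1 h2 ↦ ?_⟩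
    exact eventually_ladder_succ.2 ⟨q, h1, r, h2, hp⟩

theorem ladderDeriv_anti {i j : ℕ} (h : i ≤ j) (S : Set Ordinal.{u}) :
    ladderDeriv j S ⊆ ladderDeriv i S :=
  fun x hx ↦ Frequently.filter_mono hx (ladder_anti h x)

theorem ladderDeriv_loeb (i : ℕ) (S : Set Ordinal.{u}) :
    ladderDeriv i S ⊆ ladderDeriv i (S \ ladderDeriv i S) := by
  intro x hx
  by_contra h
  have h1 := not_frequently.1 h
  obtain ⟨y, hyS, hy⟩ : ∃ y ∈ S, ∀ᶠ z in ladder i y, z ∉ S \ ladderDeriv i S := by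
    have := hx.and_eventually (eventually_eventually_ladder i h1)
    exact this.exists
  have h2 : ∃ y ∈ S, (∀ᶠ z in ladder i y, z ∉ S \ ladderDeriv i S) ∧ y ∈ ladderDeriv i S := by
    have := hx.and_eventually (h1.and (eventually_eventually_ladder i h1))
    obtain ⟨y, hyS, h3, h4⟩ := this.exists
    exact ⟨y, hyS, h4, by_contra fun h ↦ h3 ⟨hyS, h⟩⟩
  obtain ⟨y, ⟨hyS, h3, h4⟩, hmin⟩ := WellFounded.has_min (wellFounded_lt (α := Ordinal.{u}))
    {y | y ∈ S ∧ (∀ᶠ z in ladder i y, z ∉ S \ ladderDeriv i S) ∧ y ∈ ladderDeriv i S} h2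
  have := h4.and_eventually (h3.and ((eventually_eventually_ladder i h3).and
    (ladder_le_nhdsLT i y (eventually_nhdsLT_lt y))))
  obtain ⟨z, hzS, h5, h6, h7⟩ := this.exists
  exact hmin z ⟨hzS, h6, by_contra fun h ↦ h5 ⟨hzS, h⟩⟩ h7

/-- The algebra of sets generated by the initial segments and the colouring. -/
inductive LadderAlgebra : Set Ordinal.{u} → Prop
  | iic (b : Ordinal.{u}) : LadderAlgebra (Iic b)
  | parity : LadderAlgebra {x | parity x}
  | compl {S : Set Ordinal.{u}} : LadderAlgebra S → LadderAlgebra Sᶜ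
  | union {S S' : Set Ordinal.{u}} : LadderAlgebra S → LadderAlgebra S' → LadderAlgebra (S ∪ S')
  | deriv (i : ℕ) {S : Set Ordinal.{u}} : LadderAlgebra S → LadderAlgebra (ladderDeriv i S)

theorem LadderAlgebra.univ : LadderAlgebra (univ : Set Ordinal.{u}) := by
  rw [← union_compl_self (Iic 0)]
  exact (iic 0).union (iic 0).compl

theorem LadderAlgebra.empty : LadderAlgebra (∅ : Set Ordinal.{u}) := by
  rw [← compl_univ]
  exact univ.compl

/-- Locally to the left of `x`, membership in `S` is decided by the colour and by membership of the
end-logarithm in `C`. -/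
def LeftLocal (S : Set Ordinal.{u}) (x : Ordinal.{u}) (c : Prop) (C : Set Ordinal.{u}) : Prop :=
  ∀ᶠ y in 𝓝[<] x, (y ∈ S ↔ (parity y ∧ c) ∨ (¬ parity y ∧ endLog y ∈ C))

theorem LeftLocal.eventually {S : Set Ordinal.{u}} {x : Ordinal.{u}} {c : Prop}
    {C : Set Ordinal.{u}} (h : LeftLocal S x c C) : ∀ᶠ y in 𝓝[<] x, LeftLocal S y c C :=
  eventually_eventually_nhdsLT h

theorem LeftLocal.mem_ladderDeriv_zero {S : Set Ordinal.{u}} {x : Ordinal.{u}} {c : Prop}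
    {C : Set Ordinal.{u}} (h : LeftLocal S x c C) :
    x ∈ ladderDeriv 0 S ↔ ∃ k ∈ C ∪ {z | z = 0 ∧ c}, k < endLog x := by
  constructor
  · intro hx
    obtain ⟨y, hy, h1, h2⟩ := (Frequently.and_eventually hx (h.and (eventually_endLog_lt x))).exists
    rcases h1.1 hy with ⟨hp, hc⟩ | ⟨-, hC⟩
    · exact ⟨0, .inr ⟨rfl, hc⟩, endLog_of_parity hp ▸ h2⟩
    · exact ⟨_, .inl hC, h2⟩
  · rintro ⟨k, hk, hlt⟩
    have hx0 : x ≠ 0 := by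
      rintro rfl
      rw [endLog_zero] at hlt
      exact not_lt_bot hlt
    refine ((nhdsLT_hasBasis hx0).frequently_iff).2 ?_ |>.and_eventually h |>.mono
      (p := fun y ↦ ((parity y ∧ c) ∨ (¬ parity y ∧ endLog y ∈ C)) ∧ _) fun y hy ↦ hy.2.2 hy.1
    intro a ha
    rcases hk with hk | ⟨rfl, hc⟩
    · rcases eq_or_ne k 0 with rfl | h0
      · obtain ⟨y, h1, h2, h3, h4⟩ := (exists_parity hlt ha).2
        exact ⟨y, ⟨h1, h2⟩, .inr ⟨h4, h3 ▸ hk⟩⟩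
      · obtain ⟨y, h1, h2, rfl⟩ := exists_endLog_eq ha hlt
        exact ⟨y, ⟨h1, h2⟩, .inr ⟨fun hp ↦ h0 (endLog_of_parity hp), hk⟩⟩
    · obtain ⟨y, h1, h2, h3, h4⟩ := (exists_parity hlt ha).1
      exact ⟨y, ⟨h1, h2⟩, .inl ⟨h4, hc⟩⟩

theorem LeftLocal.mem_ladderDeriv_succ {S : Set Ordinal.{u}} {x : Ordinal.{u}} {c : Prop}
    {C : Set Ordinal.{u}} (h : LeftLocal S x c C) (i : ℕ) :
    x ∈ ladderDeriv (i + 1) S ↔ endLog x ∈ ladderDeriv i C := by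
  have hpar : ∀ᶠ y in ladder (i + 1) x, ¬ parity y := by
    filter_upwards [(tendsto_endLog_ladder i x).eventually
      (ladder_le_nhdsLT i _ (eventually_nhdsLT_ne_zero _))] with y hy hp
    exact hy (endLog_of_parity hp)
  have h' := ladder_le_nhdsLT (i + 1) x h
  constructor
  · intro hx
    refine (tendsto_endLog_ladder i x).frequently
      ((Frequently.and_eventually hx (hpar.and h')).mono ?_)
    rintro y ⟨hy, hp, hiff⟩
    rcases (hiff.1 hy) with h1 | h1
    · exact absurd h1.1 hp
    · exact h1.2
  · intro hx
    suffices hfreq : ∃ᶠ y in ladder (i + 1) x, endLog y ∈ C from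
      (hfreq.and_eventually (hpar.and h')).mono fun y hy ↦ hy.2.2.2 (.inr ⟨hy.2.1, hy.1⟩)
    intro hev
    obtain ⟨q, hq, r, hr, hp⟩ := eventually_ladder_succ.1 hev
    obtain ⟨ν, hν, h1, h2⟩ := (Frequently.and_eventually hx
      (hr.and (ladder_le_nhdsLT i _ (eventually_nhdsLT_lt _)))).exists
    have hx0 : x ≠ 0 := by
      rintro rfl
      rw [endLog_zero] at h2
      exact not_lt_bot h2
    obtain ⟨a, ha, haq⟩ := (nhdsLT_hasBasis hx0).mem_iff.1 hq
    obtain ⟨y, h3, h4, rfl⟩ := exists_endLog_eq ha h2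
    exact hp y (haq ⟨h3, h4⟩) h1 hν

theorem zero_notMem_ladderDeriv (i : ℕ) (S : Set Ordinal.{u}) : 0 ∉ ladderDeriv i S := fun h ↦ by
  have := Frequently.filter_mono h (ladder_le_nhdsLT i 0)
  rw [nhdsLT_zero] at this
  exact frequently_bot this

theorem ladderAlgebra_setOf_exists_lt (K : Set Ordinal.{u}) :
    LadderAlgebra {ν | ∃ k ∈ K, k < ν} := by
  rcases K.eq_empty_or_nonempty with rfl | h
  · simpa using LadderAlgebra.empty
  · convert (LadderAlgebra.iic (sInf K)).compl using 1
    ext ν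
    simp only [mem_ofPred_eq, mem_compl_iff, mem_Iic, not_le]
    exact ⟨fun ⟨k, hk, hlt⟩ ↦ (csInf_le' hk).trans_lt hlt, fun hlt ↦ ⟨_, csInf_mem h, hlt⟩⟩

theorem LeftLocal.of_endLog {S : Set Ordinal.{u}} {x : Ordinal.{u}} {C : Set Ordinal.{u}}
    (h0 : 0 ∉ C) (h : ∀ᶠ y in 𝓝[<] x, (y ∈ S ↔ endLog y ∈ C)) : LeftLocal S x False C := by
  refine h.mono fun y hy ↦ ?_
  rw [hy]
  by_cases hp : parity y
  · simp [hp, endLog_of_parity hp, h0]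
  · simp [hp]

theorem LadderAlgebra.exists_leftLocal {S : Set Ordinal.{u}} (hS : LadderAlgebra S)
    (x : Ordinal.{u}) : ∃ c C, LadderAlgebra C ∧ LeftLocal S x c C := by
  induction hS with
  | iic b =>
    rcases le_or_gt x b with h | h
    · refine ⟨True, _, .univ, (eventually_nhdsLT_lt x).mono fun y hy ↦ ?_⟩
      simp [hy.le.trans h, em]
    · refine ⟨False, _, .empty, (eventually_nhdsLT_gt h).mono fun y hy ↦ ?_⟩
      simp [hy]
  | parity => exact ⟨True, _, .empty, .of_forall fun y ↦ by simp⟩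
  | compl _ ih =>
    obtain ⟨c, C, hC, h⟩ := ih
    refine ⟨¬ c, _, hC.compl, h.mono fun y hy ↦ ?_⟩
    rw [mem_compl_iff, hy, mem_compl_iff]
    by_cases hp : PolyGLP.parity y <;> simp [hp]
  | union _ _ ih ih' =>
    obtain ⟨c, C, hC, h⟩ := ih
    obtain ⟨c', C', hC', h'⟩ := ih'
    refine ⟨c ∨ c', _, hC.union hC', (h.and h').mono fun y hy ↦ ?_⟩
    rw [mem_union, hy.1, hy.2, mem_union]
    by_cases hp : PolyGLP.parity y <;> simp [hp]
  | deriv i _ ih =>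
    obtain ⟨c, C, hC, h⟩ := ih
    cases i with
    | zero =>
      refine ⟨_, _, ladderAlgebra_setOf_exists_lt _, .of_endLog ?_ (h.eventually.mono fun y hy ↦
        hy.mem_ladderDeriv_zero)⟩
      rintro ⟨k, -, hk⟩
      exact not_lt_bot hk
    | succ i =>
      exact ⟨_, _, hC.deriv i, .of_endLog (zero_notMem_ladderDeriv i C) (h.eventually.mono
        fun y hy ↦ hy.mem_ladderDeriv_succ i)⟩

theorem LadderAlgebra.eventually_mem_ladderDeriv {i j : ℕ} (hij : i < j) :
    ∀ {S : Set Ordinal.{u}}, LadderAlgebra S → ∀ {x}, x ∈ ladderDeriv i S →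
      ∀ᶠ y in ladder j x, y ∈ ladderDeriv i S := by
  obtain ⟨j, rfl⟩ := Nat.exists_eq_add_one_of_ne_zero (Nat.ne_zero_of_lt hij)
  induction i generalizing j with
  | zero =>
    intro S hS x hx
    obtain ⟨c, C, -, h⟩ := hS.exists_leftLocal x
    obtain ⟨k, hk, hlt⟩ := h.mem_ladderDeriv_zero.1 hx
    filter_upwards [ladder_le_nhdsLT _ _ h.eventually, (tendsto_endLog_ladder j x).eventually
      (ladder_le_nhdsLT _ _ (eventually_nhdsLT_gt hlt))] with y h1 h2
    exact h1.mem_ladderDeriv_zero.2 ⟨k, hk, h2⟩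
  | succ i ih =>
    intro S hS x hx
    obtain ⟨c, C, hC, h⟩ := hS.exists_leftLocal x
    have h1 := (h.mem_ladderDeriv_succ i).1 hx
    obtain ⟨j, rfl⟩ := Nat.exists_eq_add_one_of_ne_zero (n := j) (by omega)
    filter_upwards [ladder_le_nhdsLT _ _ h.eventually, (tendsto_endLog_ladder (j + 1) x).eventually
      (ih j (by omega) hC h1)] with y h2 h3
    exact (h2.mem_ladderDeriv_succ i).2 h3

/-! ### Soundness -/

/-- Truth sets in the model, with `[ξ]` read as the dual of the derived set operator number `k ξ`. -/
def ladderEval {Λ : Ordinal.{v}} (k : Iio Λ → ℕ) (V : ℕ → Set Ordinal.{u}) :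
    Formula Λ → Set Ordinal.{u}
  | .top => univ
  | .var n => V n
  | .neg φ => (ladderEval k V φ)ᶜ
  | .and φ ψ => ladderEval k V φ ∩ ladderEval k V ψ
  | .or φ ψ => ladderEval k V φ ∪ ladderEval k V ψ
  | .imp φ ψ => (ladderEval k V φ)ᶜ ∪ ladderEval k V ψ
  | .box ξ φ => (ladderDeriv (k ξ) (ladderEval k V φ)ᶜ)ᶜ

theorem LadderAlgebra.ladderEval {Λ : Ordinal.{v}} (k : Iio Λ → ℕ) {V : ℕ → Set Ordinal.{u}}
    (hV : ∀ n, LadderAlgebra (V n)) (φ : Formula Λ) : LadderAlgebra (ladderEval k V φ) := by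
  induction φ with
  | top => exact .univ
  | var n => exact hV n
  | neg φ ih => exact ih.compl
  | and φ ψ ih ih' =>
    rw [PolyGLP.ladderEval, ← compl_compl (_ ∩ _), compl_inter]
    exact (ih.compl.union ih'.compl).compl
  | or φ ψ ih ih' => exact ih.union ih'
  | imp φ ψ ih ih' => exact ih.compl.union ih'
  | box ξ φ ih => exact (ih.compl.deriv _).compl

/-- The number of elements of `F` below `ξ`. -/
def countBelow {α : Type v} [LinearOrder α] (F : Finset α) (ξ : α) : ℕ := (F.filter (· < ξ)).card

theorem countBelow_lt {α : Type v} [LinearOrder α] {F : Finset α} {ξ ζ : α} (hξ : ξ ∈ F)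
    (h : ξ < ζ) : countBelow F ξ < countBelow F ζ := by
  refine Finset.card_lt_card (Finset.ssubset_iff_of_subset ?_ |>.2 ⟨ξ, ?_⟩)
  · intro η hη
    rw [Finset.mem_filter] at hη ⊢
    exact ⟨hη.1, hη.2.trans h⟩
  · simp [hξ, h]

theorem GLP.exists_finset_ladderEval {Λ : Ordinal.{v}} {φ : Formula Λ} (h : GLP Λ φ) :
    ∃ F₀ : Finset (Iio Λ), ∀ F, F₀ ⊆ F → ∀ V : ℕ → Set Ordinal.{u}, (∀ n, LadderAlgebra (V n)) →
      ∀ x, x ∈ ladderEval (countBelow F) V φ := by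
  induction h with
  | @taut φ h =>
    refine ⟨∅, fun F _ V _ x ↦ h (fun ψ ↦ x ∈ ladderEval (countBelow F) V ψ) ?_⟩
    constructor
    · trivial
    · intros; rfl
    · intros; rfl
    · intros; rfl
    · intro φ ψ
      exact imp_iff_not_or.symm
  | distrib ξ φ ψ =>
    refine ⟨∅, fun F _ V _ x ↦ ?_⟩
    simp only [ladderEval, mem_union, mem_compl_iff, ladderDeriv, mem_ofPred_eq, not_frequently,
      not_not, ← imp_iff_not_or]
    exact fun h h' ↦ (h.and h').mono fun y hy ↦ hy.1 hy.2
  | loeb ξ φ =>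
    refine ⟨∅, fun F _ V _ x ↦ ?_⟩
    simp only [ladderEval, mem_union, mem_compl_iff, ← imp_iff_not_or]
    intro h h'
    refine h (Frequently.mono (ladderDeriv_loeb _ _ h') fun y hy ↦ ?_)
    simp only [mem_compl_iff, mem_union, not_or, not_not]
    exact hy.symm
  | mono ξ ζ φ hlt =>
    refine ⟨{ξ}, fun F hF V _ x ↦ ?_⟩
    have := countBelow_lt (hF (Finset.mem_singleton_self ξ)) hlt
    simp only [ladderEval, mem_union, mem_compl_iff, ← imp_iff_not_or]
    exact fun h h' ↦ h (ladderDeriv_anti this.le _ h')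
  | dia_box ξ ζ φ hlt =>
    refine ⟨{ξ}, fun F hF V hV x ↦ ?_⟩
    have := countBelow_lt (hF (Finset.mem_singleton_self ξ)) hlt
    simp only [Formula.dia, ladderEval, mem_union, mem_compl_iff, ← imp_iff_not_or, compl_compl]
    intro h h'
    have h1 := (LadderAlgebra.ladderEval _ hV φ).eventually_mem_ladderDeriv this h
    obtain ⟨y, h2, h3⟩ := (Frequently.and_eventually h' h1).exists
    exact h2 h3
  | mp _ _ ih ih' =>
    classical
    obtain ⟨F₁, h₁⟩ := ih
    obtain ⟨F₂, h₂⟩ := ih'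
    refine ⟨F₁ ∪ F₂, fun F hF V hV x ↦ ?_⟩
    have := h₁ F (Finset.union_subset_left hF) V hV x
    exact this.resolve_left fun h ↦ h (h₂ F (Finset.union_subset_right hF) V hV x)
  | nec ξ _ ih =>
    obtain ⟨F₀, h₀⟩ := ih
    refine ⟨F₀, fun F hF V hV x hx ↦ ?_⟩
    obtain ⟨y, hy⟩ := Frequently.exists hx
    exact hy (h₀ F hF V hV y)

/-! ### The countermodel -/

theorem endLog_iterate_opow (k : ℕ) (ν : Ordinal.{u}) :
    endLog^[k] ((fun x ↦ ω ^ x)^[k] ν) = ν :=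
  Function.LeftInverse.iterate endLog_opow k ν

theorem ladderDeriv_preimage_endLog (k : ℕ) (S : Set Ordinal.{u}) :
    ladderDeriv (k + 1) (endLog ⁻¹' S) = endLog ⁻¹' ladderDeriv k S := by
  ext x
  refine LeftLocal.mem_ladderDeriv_succ (c := 0 ∈ S) (.of_forall fun y ↦ ?_) k
  by_cases hp : parity y
  · simp [hp, endLog_of_parity hp]
  · simp [hp]

theorem ladderDeriv_preimage_iterate (k : ℕ) (S : Set Ordinal.{u}) :
    ladderDeriv k (endLog^[k] ⁻¹' S) = endLog^[k] ⁻¹' ladderDeriv 0 S := by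
  induction k with
  | zero => rfl
  | succ k ih =>
    rw [Function.iterate_succ, preimage_comp, ladderDeriv_preimage_endLog, ih, preimage_comp]

theorem ladderDeriv_zero_setOf_le (a : Ordinal.{u}) :
    ladderDeriv 0 {y | a ≤ endLog y} = {y | a + 1 ≤ endLog y} := by
  ext x
  rw [LeftLocal.mem_ladderDeriv_zero (c := 0 ∈ Ici a) (C := Ici a) (.of_forall fun y ↦ ?_)]
  · rw [mem_ofPred_eq, Order.add_one_le_iff]
    constructor
    · rintro ⟨k, hk | ⟨rfl, hk⟩, h⟩
      · exact (mem_Ici.1 hk).trans_lt h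
      · exact (mem_Ici.1 hk).trans_lt h
    · exact fun h ↦ ⟨a, .inl self_mem_Ici, h⟩
  · by_cases hp : parity y
    · simp [hp, endLog_of_parity hp]
    · simp [hp]

theorem compl_ladderEval_boxIterBot {Λ : Ordinal.{v}} (k : Iio Λ → ℕ) (V : ℕ → Set Ordinal.{u})
    (ξ : Iio Λ) (n : ℕ) :
    (ladderEval k V (.boxIterBot ξ n))ᶜ = endLog^[k ξ] ⁻¹' {y | (n : Ordinal.{u}) ≤ endLog y} := by
  induction n with
  | zero => simp [Formula.boxIterBot, ladderEval]
  | succ n ih =>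
    rw [Formula.boxIterBot, ladderEval, compl_compl, ih, ladderDeriv_preimage_iterate,
      ladderDeriv_zero_setOf_le, Nat.cast_succ]

theorem notMem_ladderEval_linearity {Λ : Ordinal.{v}} {k : Iio Λ → ℕ} {ξ : Iio Λ} (hk : k ξ = 0)
    {x : Ordinal.{u}} (hx : 0 < endLog x) :
    x ∉ ladderEval k (fun _ ↦ {y | parity y}) (.linearity ξ (.var 0) (.neg (.var 0))) := by
  have hx0 : x ≠ 0 := by
    rintro rfl
    rw [endLog_zero] at hx
    exact not_lt_bot hx
  have hisol : ∀ y : Ordinal.{u}, endLog y = 0 → ∀ S, y ∉ ladderDeriv 0 S := by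
    intro y hy S h
    have := (Frequently.and_eventually h (eventually_endLog_lt y)).exists
    obtain ⟨z, -, hz⟩ := this
    rw [hy] at hz
    exact not_lt_bot hz
  simp only [Formula.linearity, ladderEval, hk, mem_union, mem_compl_iff, not_or, not_not]
  constructor
  · refine (nhdsLT_hasBasis hx0).frequently_iff.2 fun {a} ha ↦ ?_
    obtain ⟨y, h1, h2, h3, h4⟩ := (exists_parity hx ha).1
    refine ⟨y, ⟨h1, h2⟩, ?_⟩
    have := hisol y h3
    simp [this, h4]
  · refine (nhdsLT_hasBasis hx0).frequently_iff.2 fun {a} ha ↦ ?_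
    obtain ⟨y, h1, h2, h3, h4⟩ := (exists_parity hx ha).2
    refine ⟨y, ⟨h1, h2⟩, ?_⟩
    have := hisol y h3
    simp [this, h4]

theorem not_GLP_boxIterBot_or_linearity {Λ : Ordinal.{v}} (hΛ : 0 < Λ) (ξ : Iio Λ) (n : ℕ) :
    ¬ GLP Λ (.or (.boxIterBot ξ n) (.linearity ⟨0, hΛ⟩ (.var 0) (.neg (.var 0)))) := by
  intro h
  obtain ⟨F, hF⟩ := h.exists_finset_ladderEval.{v, v}
  set k := countBelow F
  have hk : k ⟨0, hΛ⟩ = 0 := by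
    refine Finset.card_eq_zero.2 (Finset.filter_eq_empty_iff.2 fun η _ hη ↦ ?_)
    exact not_lt_bot (show (η : Ordinal.{v}) < 0 from hη)
  set x : Ordinal.{v} := (fun x ↦ ω ^ x)^[k ξ + 1] (n + 1)
  have hx : endLog^[k ξ + 1] x = n + 1 := endLog_iterate_opow _ _
  have hpos : 0 < endLog x := by
    refine pos_iff_ne_zero.2 fun h0 ↦ ?_
    rw [Function.iterate_succ_apply, h0, Function.iterate_fixed endLog_zero] at hx
    exact (Order.lt_add_one_iff.2 bot_le : (0 : Ordinal.{v}) < n + 1).ne hx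
  rcases hF F subset_rfl _ (fun _ ↦ .parity) x with h1 | h1
  · have h2 : x ∈ (ladderEval k (fun _ ↦ {y | parity y}) (.boxIterBot ξ n))ᶜ := by
      rw [Function.iterate_succ_apply'] at hx
      rw [compl_ladderEval_boxIterBot, mem_preimage, mem_ofPred_eq, hx]
      exact (Order.lt_add_one_iff.2 le_rfl).le
    exact h2 h1
  · exact notMem_ladderEval_linearity hk hpos h1

end

end PolyGLP

theorem mainTheorem3 (Λ Θ : Ordinal.{u}) (hΛ : 0 < Λ) (hΘ : Θ < PolyGLP.hyperexp (1 + Λ) 1) :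
    ¬ PolyGLP.GLPCompleteFor
      (PolyGLP.bgSpaces Λ Θ ∪ PolyGLP.icardAmbiances Λ Θ ∪ PolyGLP.shiftedIcardAmbiances Λ Θ) := by
  intro h
  obtain ⟨ξ, hξ, n, hn⟩ := PolyGLP.exists_lt_hyperexp_natCast hΛ hΘ
  refine PolyGLP.not_GLP_boxIterBot_or_linearity hΛ ⟨ξ, hξ⟩ n (h _ fun 𝔛 h𝔛 V hV ↦ ?_)
  rw [PolyGLP.Ambiance.eval]
  rcases h𝔛 with (h𝔛 | h𝔛) | h𝔛
  · rw [PolyGLP.bgSpaces_valid hn h𝔛 V hV, Set.univ_union]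
  · rw [PolyGLP.icardAmbiances_valid hΛ _ _ h𝔛 V hV, Set.union_univ]
  · rw [PolyGLP.shiftedIcardAmbiances_valid hn h𝔛 V hV, Set.univ_union]
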